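/- **The calculus.** Fix a denumerable set of type variables $\alpha$. *Pure types* are $A,B ::= \alpha \mid A\land B \mid A\lor B \mid A\to B \mid A\ltimes B \mid \neg A \mid \forall\alpha.A \mid \exists\alpha.A$; *types* are $P,Q ::= A^+ \mid A^- \mid A^\oplus \mid A^\ominus$. Terms of $\lambda^{\mathrm{PRK}}$, up to renaming of bound variables and with $\pm$ standing for $+$ or $-$ and $i\in\{1,2\}$, are $$t,s,u ::= x \mid t\bowtie_P s \mid \lambda_\circ^\pm(x{:}P).t \mid t\bullet^\pm s \mid \langle t,s\rangle^\pm \mid \pi_i^\pm t \mid \mathsf{in}_i^\pm t \mid \delta^\pm t\,[x{:}P.s][y{:}Q.u] \mid \lambda^\pm(x{:}P).t \mid t\,@^\pm s \mid (t;s)^\pm \mid \varrho^\pm t\,[x{:}P;y{:}Q.\,s] \mid \nu^\pm t \mid \mu^\pm t \mid \Lambda^\pm\alpha.t \mid t\,@^\pm A \mid \langle A,t\rangle^\pm \mid \nabla^\pm t\,[(\alpha,x{:}P).s].$$ Typing contexts $\Gamma$ are finite assignments of types to variables. The judgments $\Gamma\vdash t:P$ are generated by: * $\Gamma,x{:}P\vdash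 x:P$; if $\Gamma\vdash t:A^+$ and $\Gamma\vdash s:A^-$ then $\Gamma\vdash t\bowtie_P s:P$ for every $P$. * If $\Gamma,x{:}A^\ominus\vdash t:A^+$ then $\Gamma\vdash\lambda_\circ^+(x{:}A^\ominus).t:A^\oplus$. If $\Gamma\vdash t:A^\oplus$ and $\Gamma\vdash s:A^\ominus$ then $\Gamma\vdash t\bullet^+s:A^+$. * If $\Gamma\vdash t:A^\oplus$ and $\Gamma\vdash s:B^\oplus$ then $\Gamma\vdash\langle t,s\rangle^+:(A\land B)^+$. If $\Gamma\vdash t:(A_1\land A_2)^+$ then $\Gamma\vdash\pi_i^+t:A_i^\oplus$. * If $\Gamma\vdash t:A_i^\oplus$ then $\Gamma\vdash\mathsf{in}_i^+t:(A_1\lor A_2)^+$. If $\Gamma\vdash t:(A\lor B)^+$, $\Gamma,x{:}A^\oplus\vdash s:P$ and $\Gamma,y{:}B^\oplus\vdash u:P$ then $\Gamma\vdash\delta^+t\,[x{:}A^\oplus.s][y{:}B^\oplus.u]:P$. * If $\Gamma,x{:}A^\oplus\vdash t:B^\oplus$ then $\Gamma\vdash\lambda^+(x{:}A^\oplus).t:(A\to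 B)^+$. If $\Gamma\vdash t:(A\to B)^+$ and $\Gamma\vdash s:A^\oplus$ then $\Gamma\vdash t\,@^+s:B^\oplus$. * If $\Gamma\vdash t:A^\ominus$ and $\Gamma\vdash s:B^\oplus$ then $\Gamma\vdash(t;s)^+:(A\ltimes B)^+$. If $\Gamma\vdash t:(A\ltimes B)^+$ and $\Gamma,x{:}A^\ominus,y{:}B^\oplus\vdash s:P$ then $\Gamma\vdash\varrho^+t\,[x{:}A^\ominus;y{:}B^\oplus.\,s]:P$. * If $\Gamma\vdash t:A^\ominus$ then $\Gamma\vdash\nu^+t:(\neg A)^+$. If $\Gamma\vdash t:(\neg A)^+$ then $\Gamma\vdash\mu^+t:A^\ominus$. * If $\Gamma\vdash t:A^\oplus$ and $\alpha$ is not free in $\Gamma$ then $\Gamma\vdash\Lambda^+\alpha.t:(\forall\alpha.A)^+$. If $\Gamma\vdash t:(\forall\alpha.B)^+$ then $\Gamma\vdash t\,@^+A:(B\{\alpha:=A\})^\oplus$. * If $\Gamma\vdash t:(B\{\alpha:=A\})^\oplus$ then $\Gamma\vdash\langle A,t\rangle^+:(\exists\alpha.B)^+$. If $\Gamma\vdash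 t:(\exists\alpha.A)^+$, $\Gamma,x{:}A^\oplus\vdash s:P$ and $\alpha$ is not free in $\Gamma,P$ then $\Gamma\vdash\nabla^+t\,[(\alpha,x{:}A^\oplus).s]:P$. * The dual of every rule except the first two, obtained by exchanging $+$ with $-$, $\oplus$ with $\ominus$, $\land$ with $\lor$, $\to$ with $\ltimes$ and $\forall$ with $\exists$ ($\neg$ is self-dual). *Reduction* $\to$ on typable terms is the closure under arbitrary contexts of the following rules, where all occurrences of $\pm$ in a rule stand for the same sign: $$\begin{array}{ll} (\lambda_\circ^\pm x.t)\bullet^\pm s\to t\{x:=s\} & \pi_i^\pm\langle t_1,t_2\rangle^\pm\to t_i\\ \delta^\pm(\mathsf{in}_i^\pm t)[x.s_1][x.s_2]\to s_i\{x:=t\} & (\lambda^\pm x.t)\,@^\pm s\to t\{x:=s\}\\ \varrho^\pm(t;s)^\pm[x;y.u]\to u\{x:=t\}\{y:=s\} & \mu^\pm\nu^\pm t\to t\\ (\Lambda^\pm\alpha.t)\,@^\pm A\to t\{\alpha:=A\} & \nabla^\pm\langle A,t\rangle^\pm[(\alpha,x).s]\to s\{\alpha:=A\}\{x:=t\}\\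 \langle t_1,t_2\rangle^+\bowtie_Q\mathsf{in}_i^-s\to t_i\bowtie'_Q s & \mathsf{in}_i^+t\bowtie_Q\langle s_1,s_2\rangle^-\to t\bowtie'_Q s_i\\ (\lambda^+x.t)\bowtie_Q(s;u)^-\to t\{x:=s\}\bowtie'_Q u & (t;s)^+\bowtie_Q(\lambda^-x.u)\to s\bowtie'_Q u\{x:=t\}\\ (\Lambda^+\alpha.t)\bowtie_Q\langle A,s\rangle^-\to t\{\alpha:=A\}\bowtie'_Q s & \langle A,t\rangle^+\bowtie_Q(\Lambda^-\alpha.s)\to t\bowtie'_Q s\{\alpha:=A\}\\ (\nu^+t)\bowtie_Q(\nu^-s)\to s\bowtie'_Q t & \end{array}$$ Here $a\bowtie'_Q b$ abbreviates $(a\bullet^+b)\bowtie_Q(b\bullet^-a)$ (in each rule $a$ has a type $A^\oplus$ and $b$ has type $A^\ominus$). The optional rule $\eta_\circ$ is $\lambda_\circ^\pm(x{:}P).(t\bullet^\pm x)\to t$ for $x$ not free in $t$. A sequent $P_1,\dots,P_n\vdash Q$ *holds in* $\lambda^{\mathrm{PRK}}$ if $x_1{:}P_1,\dots,x_n{:}P_n\vdash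 t:Q$ for some term $t$. $\mathrm{NK}$ is classical second-order propositional natural deduction over the formulas built like pure types with an additional constant $\bot$. It has the usual introduction and elimination rules for $\land,\lor,\to,\neg$ (where $\neg$ is primitive, with rules: $\Gamma,A\vdash\bot$ gives $\Gamma\vdash\neg A$; $\Gamma\vdash\neg A$ and $\Gamma\vdash A$ give $\Gamma\vdash\bot$) and for $\forall,\exists$ (instantiated by arbitrary formulas). It also has the rules: $\Gamma\vdash\bot$ gives $\Gamma\vdash A$; $\Gamma\vdash\neg A$ and $\Gamma\vdash B$ give $\Gamma\vdash A\ltimes B$; $\Gamma\vdash A\ltimes B$ and $\Gamma,\neg A,B\vdash C$ give $\Gamma\vdash C$; and the axiom $\Gamma\vdash A\lor\neg A$. **Theorem.** For $\lambda^{\mathrm{PRK}}$, with or without the rule $\eta_\circ$: 1. (Subject reduction) If $\Gamma\vdash t:P$ and $t\to s$, then $\Gamma\vdash s:P$. 2. (Confluence) Reduction on typable terms has the Church–Rosser property: any two terms that are convertible (related by the equivalence relation generated by $\to$) have a common reduct. 3. (Classical refinement) For all $n\ge 0$ and all pure types $A_1,\dots,A_n,B$: the sequent $A_1^\oplus,\dots,A_n^\oplus\vdash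 B^\oplus$ holds in $\lambda^{\mathrm{PRK}}$ if and only if $A_1,\dots,A_n\vdash B$ is derivable in $\mathrm{NK}$. -/

import Mathlib

/-!
Second-order `λ^PRK`, in de Bruijn style: terms and types "up to renaming of bound variables" are
represented by de Bruijn terms.  A free index stands for the corresponding element of the
denumerable set of (type) variables.  Types of binders are part of the terms; the type of a free
variable is recorded in the typing context.
-/

namespace PRK

/-- Extend a sequence by a new element for index `0`. -/
def scons {α : Type} (a : α) (f : ℕ → α) : ℕ → α
  | 0 => a
  | n + 1 => f n

/-- Lift a renaming of indices under a binder. -/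
def upRen (ξ : ℕ → ℕ) : ℕ → ℕ := scons 0 (fun n => ξ n + 1)

/-! ### Types -/

/-- Pure types `A ::= α | A ∧ A | A ∨ A | A → A | A ⋉ A | ¬A | ∀α.A | ∃α.A`. -/
inductive PType : Type
  | var (n : ℕ)
  | and (A B : PType)
  | or (A B : PType)
  | imp (A B : PType)
  | coimp (A B : PType)
  | not (A : PType)
  | all (A : PType)
  | ex (A : PType)

namespace PType

/-- Rename type variables. -/
def rename : (ℕ → ℕ) → PType → PType
  | ξ, var n => var (ξ n)
  | ξ, and A B => and (rename ξ A) (rename ξ B)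
  | ξ, or A B => or (rename ξ A) (rename ξ B)
  | ξ, imp A B => imp (rename ξ A) (rename ξ B)
  | ξ, coimp A B => coimp (rename ξ A) (rename ξ B)
  | ξ, not A => not (rename ξ A)
  | ξ, all A => all (rename (upRen ξ) A)
  | ξ, ex A => ex (rename (upRen ξ) A)

/-- `A` seen in the scope of one more type variable (which does not occur in it). -/
def shift (A : PType) : PType := A.rename Nat.succ

/-- Lift a substitution of pure types for type variables under a binder. -/
def up (σ : ℕ → PType) : ℕ → PType := scons (var 0) (fun n => (σ n).shift)

/-- Simultaneous capture-avoiding substitution of pure types for type variables. -/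
def subst : (ℕ → PType) → PType → PType
  | σ, var n => σ n
  | σ, and A B => and (subst σ A) (subst σ B)
  | σ, or A B => or (subst σ A) (subst σ B)
  | σ, imp A B => imp (subst σ A) (subst σ B)
  | σ, coimp A B => coimp (subst σ A) (subst σ B)
  | σ, not A => not (subst σ A)
  | σ, all A => all (subst (up σ) A)
  | σ, ex A => ex (subst (up σ) A)

/-- `B.inst A` is `B{α := A}`, where `α` is the type variable with index `0` in `B`. -/
def inst (B A : PType) : PType := B.subst (scons A var)

end PType

/-- Types `P ::= A⁺ | A⁻ | A^⊕ | A^⊖`. -/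
inductive Ty : Type
  /-- strong affirmation `A⁺` -/
  | sp (A : PType)
  /-- strong denial `A⁻` -/
  | sn (A : PType)
  /-- weak affirmation `A^⊕` -/
  | wp (A : PType)
  /-- weak denial `A^⊖` -/
  | wn (A : PType)

namespace Ty

/-- Apply an operation to the pure type below the mode. -/
def map (f : PType → PType) : Ty → Ty
  | sp A => sp (f A)
  | sn A => sn (f A)
  | wp A => wp (f A)
  | wn A => wn (f A)

/-- `P` seen in the scope of one more type variable (which does not occur in it). -/
def shift (P : Ty) : Ty := P.map PType.shift

/-- Simultaneous capture-avoiding substitution of pure types for type variables. -/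
def subst (σ : ℕ → PType) (P : Ty) : Ty := P.map (PType.subst σ)

end Ty

/-! ### Terms -/

/-- The signs `+` and `-` that decorate terms. -/
inductive Sign : Type
  | pos
  | neg

/-- The indices `i ∈ {1, 2}`. -/
inductive Idx : Type
  | one
  | two

/-- `i.pick a₁ a₂` is `aᵢ`. -/
def Idx.pick {α : Type} (i : Idx) (a₁ a₂ : α) : α :=
  match i with
  | one => a₁
  | two => a₂

/-- Terms of `λ^PRK`. -/
inductive Tm : Type
  /-- variable -/
  | var (n : ℕ)
  /-- absurdity `t ⋈_P s` -/
  | sabs (P : Ty) (t s : Tm)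
  /-- introduction of `⊕` / `⊖`: the abstraction `λ∘^±(x:P). t`; binds `x` in `t` -/
  | clam (ε : Sign) (P : Ty) (t : Tm)
  /-- elimination of `⊕` / `⊖`: the application `t ∘^± s` -/
  | capp (ε : Sign) (t s : Tm)
  /-- `⟨t, s⟩^±` -/
  | pair (ε : Sign) (t s : Tm)
  /-- `πᵢ^±(t)` -/
  | proj (ε : Sign) (i : Idx) (t : Tm)
  /-- `inᵢ^±(t)` -/
  | inj (ε : Sign) (i : Idx) (t : Tm)
  /-- `δ^± t [x:P. s][y:Q. u]`; binds `x` in `s` and `y` in `u` -/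
  | caseOf (ε : Sign) (t : Tm) (P : Ty) (s : Tm) (Q : Ty) (u : Tm)
  /-- `λ^±(x:P). t`; binds `x` in `t` -/
  | lam (ε : Sign) (P : Ty) (t : Tm)
  /-- `t @^± s` -/
  | app (ε : Sign) (t s : Tm)
  /-- the introduction `(t ; s)^±` of `⋉⁺` / `→⁻` -/
  | copair (ε : Sign) (t s : Tm)
  /-- the elimination of `⋉⁺` / `→⁻`; binds `x : P` (index `1`) and `y : Q` (index `0`) in `s` -/
  | colam (ε : Sign) (t : Tm) (P Q : Ty) (s : Tm)
  /-- introduction of `¬` -/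
  | negI (ε : Sign) (t : Tm)
  /-- elimination of `¬` -/
  | negE (ε : Sign) (t : Tm)
  /-- `Λ^± α. t`; binds the type variable `α` in `t` -/
  | tlam (ε : Sign) (t : Tm)
  /-- type application `t @^± A` -/
  | tapp (ε : Sign) (t : Tm) (A : PType)
  /-- the introduction `⟨A, t⟩^±` of `∃⁺` / `∀⁻` -/
  | pack (ε : Sign) (A : PType) (t : Tm)
  /-- the elimination of `∃⁺` / `∀⁻`; binds the type variable `α` in `P` and `s`, and `x : P`
  in `s` -/
  | unpack (ε : Sign) (t : Tm) (P : Ty) (s : Tm)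

namespace Tm

/-- Rename term variables. -/
def rename : (ℕ → ℕ) → Tm → Tm
  | ξ, var n => var (ξ n)
  | ξ, sabs P t s => sabs P (rename ξ t) (rename ξ s)
  | ξ, clam ε P t => clam ε P (rename (upRen ξ) t)
  | ξ, capp ε t s => capp ε (rename ξ t) (rename ξ s)
  | ξ, pair ε t s => pair ε (rename ξ t) (rename ξ s)
  | ξ, proj ε i t => proj ε i (rename ξ t)
  | ξ, inj ε i t => inj ε i (rename ξ t)
  | ξ, caseOf ε t P s Q u =>
      caseOf ε (rename ξ t) P (rename (upRen ξ) s) Q (rename (upRen ξ) u)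
  | ξ, lam ε P t => lam ε P (rename (upRen ξ) t)
  | ξ, app ε t s => app ε (rename ξ t) (rename ξ s)
  | ξ, copair ε t s => copair ε (rename ξ t) (rename ξ s)
  | ξ, colam ε t P Q s => colam ε (rename ξ t) P Q (rename (upRen (upRen ξ)) s)
  | ξ, negI ε t => negI ε (rename ξ t)
  | ξ, negE ε t => negE ε (rename ξ t)
  | ξ, tlam ε t => tlam ε (rename ξ t)
  | ξ, tapp ε t A => tapp ε (rename ξ t) A
  | ξ, pack ε A t => pack ε A (rename ξ t)
  | ξ, unpack ε t P s => unpack ε (rename ξ t) P (rename (upRen ξ) s)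

/-- Simultaneous capture-avoiding substitution of pure types for the type variables of a term. -/
def tsubst : (ℕ → PType) → Tm → Tm
  | _, var n => var n
  | σ, sabs P t s => sabs (P.subst σ) (tsubst σ t) (tsubst σ s)
  | σ, clam ε P t => clam ε (P.subst σ) (tsubst σ t)
  | σ, capp ε t s => capp ε (tsubst σ t) (tsubst σ s)
  | σ, pair ε t s => pair ε (tsubst σ t) (tsubst σ s)
  | σ, proj ε i t => proj ε i (tsubst σ t)
  | σ, inj ε i t => inj ε i (tsubst σ t)
  | σ, caseOf ε t P s Q u =>
      caseOf ε (tsubst σ t) (P.subst σ) (tsubst σ s) (Q.subst σ) (tsubst σ u)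
  | σ, lam ε P t => lam ε (P.subst σ) (tsubst σ t)
  | σ, app ε t s => app ε (tsubst σ t) (tsubst σ s)
  | σ, copair ε t s => copair ε (tsubst σ t) (tsubst σ s)
  | σ, colam ε t P Q s => colam ε (tsubst σ t) (P.subst σ) (Q.subst σ) (tsubst σ s)
  | σ, negI ε t => negI ε (tsubst σ t)
  | σ, negE ε t => negE ε (tsubst σ t)
  | σ, tlam ε t => tlam ε (tsubst (PType.up σ) t)
  | σ, tapp ε t A => tapp ε (tsubst σ t) (A.subst σ)
  | σ, pack ε A t => pack ε (A.subst σ) (tsubst σ t)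
  | σ, unpack ε t P s =>
      unpack ε (tsubst σ t) (P.subst (PType.up σ)) (tsubst (PType.up σ) s)

/-- `t` seen in the scope of one more type variable (which does not occur in it). -/
def tshift (t : Tm) : Tm := t.tsubst (fun n => PType.var (n + 1))

/-- Lift a substitution of terms under a binder for a term variable. -/
def up (σ : ℕ → Tm) : ℕ → Tm := scons (var 0) (fun n => (σ n).rename Nat.succ)

/-- Lift a substitution of terms under a binder for a type variable. -/
def upT (σ : ℕ → Tm) : ℕ → Tm := fun n => (σ n).tshift

/-- Simultaneous capture-avoiding substitution of terms for term variables. -/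
def subst : (ℕ → Tm) → Tm → Tm
  | σ, var n => σ n
  | σ, sabs P t s => sabs P (subst σ t) (subst σ s)
  | σ, clam ε P t => clam ε P (subst (up σ) t)
  | σ, capp ε t s => capp ε (subst σ t) (subst σ s)
  | σ, pair ε t s => pair ε (subst σ t) (subst σ s)
  | σ, proj ε i t => proj ε i (subst σ t)
  | σ, inj ε i t => inj ε i (subst σ t)
  | σ, caseOf ε t P s Q u =>
      caseOf ε (subst σ t) P (subst (up σ) s) Q (subst (up σ) u)
  | σ, lam ε P t => lam ε P (subst (up σ) t)
  | σ, app ε t s => app ε (subst σ t) (subst σ s)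
  | σ, copair ε t s => copair ε (subst σ t) (subst σ s)
  | σ, colam ε t P Q s => colam ε (subst σ t) P Q (subst (up (up σ)) s)
  | σ, negI ε t => negI ε (subst σ t)
  | σ, negE ε t => negE ε (subst σ t)
  | σ, tlam ε t => tlam ε (subst (upT σ) t)
  | σ, tapp ε t A => tapp ε (subst σ t) A
  | σ, pack ε A t => pack ε A (subst σ t)
  | σ, unpack ε t P s => unpack ε (subst σ t) P (subst (up (upT σ)) s)

/-- `t.inst s` is `t{x := s}`, where `x` is the term variable with index `0` in `t`. -/
def inst (t s : Tm) : Tm := t.subst (scons s var)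

/-- `u.inst₂ t s` is `u{x := t}{y := s}`, where `x` has index `1` and `y` has index `0` in `u`
(`y` is not free in `t`, so that the two substitutions may be done at once). -/
def inst₂ (u t s : Tm) : Tm := u.subst (scons s (scons t var))

/-- `t.tinst A` is `t{α := A}`, where `α` is the type variable with index `0` in `t`. -/
def tinst (t : Tm) (A : PType) : Tm := t.tsubst (scons A PType.var)

/-- Generalized absurdity of type `Q` from `t : A^⊕` and `s : A^⊖`.  (From strong arguments the
generalized absurdity is `sabs` itself; the rewriting rules only need it for weak ones.) -/
def gabsPos (Q : Ty) (t s : Tm) : Tm := sabs Q (capp Sign.pos t s) (capp Sign.neg s t)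

/-- Generalized absurdity of type `Q` from `t : A^⊖` and `s : A^⊕`. -/
def gabsNeg (Q : Ty) (t s : Tm) : Tm := sabs Q (capp Sign.pos s t) (capp Sign.neg t s)

end Tm

/-! ### Typing -/

/-- Typing contexts; the `n`-th entry is the type of the variable with index `n`. -/
abbrev Ctx : Type := List Ty

/-- The context in the scope of one more type variable, which is not free in it. -/
def Ctx.shift (Γ : Ctx) : Ctx := List.map Ty.shift Γ

open Ty Sign in
/-- The typing judgment `Γ ⊢ t : P` of `λ^PRK`.  The side conditions `α ∉ ftv(Γ)` and
`α ∉ ftv(Γ, P)` are expressed by shifting `Γ` and `P`. -/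
inductive HasType : Ctx → Tm → Ty → Prop
  | ax {Γ : Ctx} {n : ℕ} {P : Ty} : Γ[n]? = some P → HasType Γ (.var n) P
  | abs {Γ : Ctx} {t s : Tm} {A : PType} {P : Ty} :
      HasType Γ t (sp A) → HasType Γ s (sn A) → HasType Γ (.sabs P t s) P
  -- weak affirmation and denial
  | clamPos {Γ : Ctx} {t : Tm} {A : PType} :
      HasType (wn A :: Γ) t (sp A) → HasType Γ (.clam pos (wn A) t) (wp A)
  | clamNeg {Γ : Ctx} {t : Tm} {A : PType} :
      HasType (wp A :: Γ) t (sn A) → HasType Γ (.clam neg (wp A) t) (wn A)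
  | cappPos {Γ : Ctx} {t s : Tm} {A : PType} :
      HasType Γ t (wp A) → HasType Γ s (wn A) → HasType Γ (.capp pos t s) (sp A)
  | cappNeg {Γ : Ctx} {t s : Tm} {A : PType} :
      HasType Γ t (wn A) → HasType Γ s (wp A) → HasType Γ (.capp neg t s) (sn A)
  -- conjunction and disjunction
  | pairPos {Γ : Ctx} {t s : Tm} {A B : PType} :
      HasType Γ t (wp A) → HasType Γ s (wp B) → HasType Γ (.pair pos t s) (sp (.and A B))
  | pairNeg {Γ : Ctx} {t s : Tm} {A B : PType} :
      HasType Γ t (wn A) → HasType Γ s (wn B) → HasType Γ (.pair neg t s) (sn (.or A B))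
  | projPos {Γ : Ctx} {t : Tm} {A₁ A₂ : PType} (i : Idx) :
      HasType Γ t (sp (.and A₁ A₂)) → HasType Γ (.proj pos i t) (wp (i.pick A₁ A₂))
  | projNeg {Γ : Ctx} {t : Tm} {A₁ A₂ : PType} (i : Idx) :
      HasType Γ t (sn (.or A₁ A₂)) → HasType Γ (.proj neg i t) (wn (i.pick A₁ A₂))
  | injPos {Γ : Ctx} {t : Tm} {A₁ A₂ : PType} (i : Idx) :
      HasType Γ t (wp (i.pick A₁ A₂)) → HasType Γ (.inj pos i t) (sp (.or A₁ A₂))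
  | injNeg {Γ : Ctx} {t : Tm} {A₁ A₂ : PType} (i : Idx) :
      HasType Γ t (wn (i.pick A₁ A₂)) → HasType Γ (.inj neg i t) (sn (.and A₁ A₂))
  | casePos {Γ : Ctx} {t s u : Tm} {A B : PType} {P : Ty} :
      HasType Γ t (sp (.or A B)) → HasType (wp A :: Γ) s P → HasType (wp B :: Γ) u P →
      HasType Γ (.caseOf pos t (wp A) s (wp B) u) P
  | caseNeg {Γ : Ctx} {t s u : Tm} {A B : PType} {P : Ty} :
      HasType Γ t (sn (.and A B)) → HasType (wn A :: Γ) s P → HasType (wn B :: Γ) u P →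
      HasType Γ (.caseOf neg t (wn A) s (wn B) u) P
  -- implication and co-implication
  | lamPos {Γ : Ctx} {t : Tm} {A B : PType} :
      HasType (wp A :: Γ) t (wp B) → HasType Γ (.lam pos (wp A) t) (sp (.imp A B))
  | lamNeg {Γ : Ctx} {t : Tm} {A B : PType} :
      HasType (wn A :: Γ) t (wn B) → HasType Γ (.lam neg (wn A) t) (sn (.coimp A B))
  | appPos {Γ : Ctx} {t s : Tm} {A B : PType} :
      HasType Γ t (sp (.imp A B)) → HasType Γ s (wp A) → HasType Γ (.app pos t s) (wp B)
  | appNeg {Γ : Ctx} {t s : Tm} {A B : PType} :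
      HasType Γ t (sn (.coimp A B)) → HasType Γ s (wn A) → HasType Γ (.app neg t s) (wn B)
  | copairPos {Γ : Ctx} {t s : Tm} {A B : PType} :
      HasType Γ t (wn A) → HasType Γ s (wp B) → HasType Γ (.copair pos t s) (sp (.coimp A B))
  | copairNeg {Γ : Ctx} {t s : Tm} {A B : PType} :
      HasType Γ t (wp A) → HasType Γ s (wn B) → HasType Γ (.copair neg t s) (sn (.imp A B))
  | colamPos {Γ : Ctx} {t s : Tm} {A B : PType} {P : Ty} :
      HasType Γ t (sp (.coimp A B)) → HasType (wp B :: wn A :: Γ) s P →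
      HasType Γ (.colam pos t (wn A) (wp B) s) P
  | colamNeg {Γ : Ctx} {t s : Tm} {A B : PType} {P : Ty} :
      HasType Γ t (sn (.imp A B)) → HasType (wn B :: wp A :: Γ) s P →
      HasType Γ (.colam neg t (wp A) (wn B) s) P
  -- negation
  | negIPos {Γ : Ctx} {t : Tm} {A : PType} :
      HasType Γ t (wn A) → HasType Γ (.negI pos t) (sp (.not A))
  | negINeg {Γ : Ctx} {t : Tm} {A : PType} :
      HasType Γ t (wp A) → HasType Γ (.negI neg t) (sn (.not A))
  | negEPos {Γ : Ctx} {t : Tm} {A : PType} :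
      HasType Γ t (sp (.not A)) → HasType Γ (.negE pos t) (wn A)
  | negENeg {Γ : Ctx} {t : Tm} {A : PType} :
      HasType Γ t (sn (.not A)) → HasType Γ (.negE neg t) (wp A)
  -- second-order quantification
  | tlamPos {Γ : Ctx} {t : Tm} {A : PType} :
      HasType Γ.shift t (wp A) → HasType Γ (.tlam pos t) (sp (.all A))
  | tlamNeg {Γ : Ctx} {t : Tm} {A : PType} :
      HasType Γ.shift t (wn A) → HasType Γ (.tlam neg t) (sn (.ex A))
  | tappPos {Γ : Ctx} {t : Tm} {A B : PType} :
      HasType Γ t (sp (.all B)) → HasType Γ (.tapp pos t A) (wp (B.inst A))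
  | tappNeg {Γ : Ctx} {t : Tm} {A B : PType} :
      HasType Γ t (sn (.ex B)) → HasType Γ (.tapp neg t A) (wn (B.inst A))
  | packPos {Γ : Ctx} {t : Tm} {A B : PType} :
      HasType Γ t (wp (B.inst A)) → HasType Γ (.pack pos A t) (sp (.ex B))
  | packNeg {Γ : Ctx} {t : Tm} {A B : PType} :
      HasType Γ t (wn (B.inst A)) → HasType Γ (.pack neg A t) (sn (.all B))
  | unpackPos {Γ : Ctx} {t s : Tm} {A : PType} {P : Ty} :
      HasType Γ t (sp (.ex A)) → HasType (wp A :: Γ.shift) s P.shift →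
      HasType Γ (.unpack pos t (wp A) s) P
  | unpackNeg {Γ : Ctx} {t s : Tm} {A : PType} {P : Ty} :
      HasType Γ t (sn (.all A)) → HasType (wn A :: Γ.shift) s P.shift →
      HasType Γ (.unpack neg t (wn A) s) P

/-- The sequent `P₁, …, Pₙ ⊢ Q` holds in `λ^PRK`: some term inhabits it. -/
def Derivable (Γ : Ctx) (Q : Ty) : Prop := ∃ t : Tm, HasType Γ t Q

/-- A term is typable if it has some type in some context. -/
def Typable (t : Tm) : Prop := ∃ (Γ : Ctx) (P : Ty), HasType Γ t P

/-! ### Reduction -/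

open Sign in
/-- The rewriting rules of `λ^PRK`, at the root of a term, without the rule `η∘`. -/
inductive Rule : Tm → Tm → Prop
  | clas (ε : Sign) (P : Ty) (t s : Tm) :
      Rule (.capp ε (.clam ε P t) s) (t.inst s)
  | proj (ε : Sign) (i : Idx) (t₁ t₂ : Tm) :
      Rule (.proj ε i (.pair ε t₁ t₂)) (i.pick t₁ t₂)
  | caseOf (ε : Sign) (i : Idx) (t : Tm) (P₁ : Ty) (s₁ : Tm) (P₂ : Ty) (s₂ : Tm) :
      Rule (.caseOf ε (.inj ε i t) P₁ s₁ P₂ s₂) ((i.pick s₁ s₂).inst t)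
  | lam (ε : Sign) (P : Ty) (t s : Tm) :
      Rule (.app ε (.lam ε P t) s) (t.inst s)
  | colam (ε : Sign) (t s : Tm) (P Q : Ty) (u : Tm) :
      Rule (.colam ε (.copair ε t s) P Q u) (u.inst₂ t s)
  | neg (ε : Sign) (t : Tm) :
      Rule (.negE ε (.negI ε t)) t
  | tlam (ε : Sign) (t : Tm) (A : PType) :
      Rule (.tapp ε (.tlam ε t) A) (t.tinst A)
  | unpack (ε : Sign) (A : PType) (t : Tm) (P : Ty) (s : Tm) :
      Rule (.unpack ε (.pack ε A t) P s) ((s.tinst A).inst t)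
  | absAnd (i : Idx) (Q : Ty) (t₁ t₂ s : Tm) :
      Rule (.sabs Q (.pair pos t₁ t₂) (.inj neg i s)) (.gabsPos Q (i.pick t₁ t₂) s)
  | absOr (i : Idx) (Q : Ty) (t s₁ s₂ : Tm) :
      Rule (.sabs Q (.inj pos i t) (.pair neg s₁ s₂)) (.gabsPos Q t (i.pick s₁ s₂))
  | absImp (Q P : Ty) (t s u : Tm) :
      Rule (.sabs Q (.lam pos P t) (.copair neg s u)) (.gabsPos Q (t.inst s) u)
  | absCoimp (Q P : Ty) (t s u : Tm) :
      Rule (.sabs Q (.copair pos t s) (.lam neg P u)) (.gabsPos Q s (u.inst t))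
  | absNeg (Q : Ty) (t s : Tm) :
      Rule (.sabs Q (.negI pos t) (.negI neg s)) (.gabsNeg Q t s)
  | absAll (Q : Ty) (A : PType) (t s : Tm) :
      Rule (.sabs Q (.tlam pos t) (.pack neg A s)) (.gabsPos Q (t.tinst A) s)
  | absEx (Q : Ty) (A : PType) (t s : Tm) :
      Rule (.sabs Q (.pack pos A t) (.tlam neg s)) (.gabsPos Q t (s.tinst A))

/-- The rule `η∘` at the root of a term: `λ∘^±(x:P). (t ∘^± x)` rewrites to `t` if `x` is not
free in `t`. -/
inductive EtaRule : Tm → Tm → Prop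
  | eta (ε : Sign) (P : Ty) (t : Tm) :
      EtaRule (.clam ε P (.capp ε (t.rename Nat.succ) (.var 0))) t

/-- Closure of a relation under arbitrary term contexts. -/
inductive Compat (R : Tm → Tm → Prop) : Tm → Tm → Prop
  | root {t t' : Tm} : R t t' → Compat R t t'
  | sabsL {P : Ty} {t t' s : Tm} : Compat R t t' → Compat R (.sabs P t s) (.sabs P t' s)
  | sabsR {P : Ty} {t s s' : Tm} : Compat R s s' → Compat R (.sabs P t s) (.sabs P t s')
  | clam {ε : Sign} {P : Ty} {t t' : Tm} : Compat R t t' → Compat R (.clam ε P t) (.clam ε P t')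
  | cappL {ε : Sign} {t t' s : Tm} : Compat R t t' → Compat R (.capp ε t s) (.capp ε t' s)
  | cappR {ε : Sign} {t s s' : Tm} : Compat R s s' → Compat R (.capp ε t s) (.capp ε t s')
  | pairL {ε : Sign} {t t' s : Tm} : Compat R t t' → Compat R (.pair ε t s) (.pair ε t' s)
  | pairR {ε : Sign} {t s s' : Tm} : Compat R s s' → Compat R (.pair ε t s) (.pair ε t s')
  | proj {ε : Sign} {i : Idx} {t t' : Tm} : Compat R t t' → Compat R (.proj ε i t) (.proj ε i t')
  | inj {ε : Sign} {i : Idx} {t t' : Tm} : Compat R t t' → Compat R (.inj ε i t) (.inj ε i t')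
  | case₀ {ε : Sign} {t t' : Tm} {P : Ty} {s : Tm} {Q : Ty} {u : Tm} :
      Compat R t t' → Compat R (.caseOf ε t P s Q u) (.caseOf ε t' P s Q u)
  | case₁ {ε : Sign} {t : Tm} {P : Ty} {s s' : Tm} {Q : Ty} {u : Tm} :
      Compat R s s' → Compat R (.caseOf ε t P s Q u) (.caseOf ε t P s' Q u)
  | case₂ {ε : Sign} {t : Tm} {P : Ty} {s : Tm} {Q : Ty} {u u' : Tm} :
      Compat R u u' → Compat R (.caseOf ε t P s Q u) (.caseOf ε t P s Q u')
  | lam {ε : Sign} {P : Ty} {t t' : Tm} : Compat R t t' → Compat R (.lam ε P t) (.lam ε P t')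
  | appL {ε : Sign} {t t' s : Tm} : Compat R t t' → Compat R (.app ε t s) (.app ε t' s)
  | appR {ε : Sign} {t s s' : Tm} : Compat R s s' → Compat R (.app ε t s) (.app ε t s')
  | copairL {ε : Sign} {t t' s : Tm} : Compat R t t' → Compat R (.copair ε t s) (.copair ε t' s)
  | copairR {ε : Sign} {t s s' : Tm} : Compat R s s' → Compat R (.copair ε t s) (.copair ε t s')
  | colamL {ε : Sign} {t t' : Tm} {P Q : Ty} {s : Tm} :
      Compat R t t' → Compat R (.colam ε t P Q s) (.colam ε t' P Q s)
  | colamR {ε : Sign} {t : Tm} {P Q : Ty} {s s' : Tm} :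
      Compat R s s' → Compat R (.colam ε t P Q s) (.colam ε t P Q s')
  | negI {ε : Sign} {t t' : Tm} : Compat R t t' → Compat R (.negI ε t) (.negI ε t')
  | negE {ε : Sign} {t t' : Tm} : Compat R t t' → Compat R (.negE ε t) (.negE ε t')
  | tlam {ε : Sign} {t t' : Tm} : Compat R t t' → Compat R (.tlam ε t) (.tlam ε t')
  | tapp {ε : Sign} {t t' : Tm} {A : PType} : Compat R t t' → Compat R (.tapp ε t A) (.tapp ε t' A)
  | pack {ε : Sign} {A : PType} {t t' : Tm} : Compat R t t' → Compat R (.pack ε A t) (.pack ε A t')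
  | unpackL {ε : Sign} {t t' : Tm} {P : Ty} {s : Tm} :
      Compat R t t' → Compat R (.unpack ε t P s) (.unpack ε t' P s)
  | unpackR {ε : Sign} {t : Tm} {P : Ty} {s s' : Tm} :
      Compat R s s' → Compat R (.unpack ε t P s) (.unpack ε t P s')

/-- One-step reduction, without the rule `η∘` if `η = false`, and with it if `η = true`. -/
def Step (η : Bool) : Tm → Tm → Prop :=
  Compat (fun t s => Rule t s ∨ (η = true ∧ EtaRule t s))

/-- One-step reduction of `λ^PRK`, as a relation on the set of typable terms. -/
def TStep (η : Bool) (t s : {t : Tm // Typable t}) : Prop := Step η t.1 s.1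

/-- The Church–Rosser property: convertible elements have a common reduct. -/
def ChurchRosser {α : Type} (r : α → α → Prop) : Prop :=
  ∀ a b : α, Relation.EqvGen r a b →
    ∃ c : α, Relation.ReflTransGen r a c ∧ Relation.ReflTransGen r b c

/-! ### Classical second-order natural deduction -/

/-- Formulas of natural deduction: they extend the pure types by `⊥`. -/
inductive Formula : Type
  | var (n : ℕ)
  | bot
  | and (A B : Formula)
  | or (A B : Formula)
  | imp (A B : Formula)
  | coimp (A B : Formula)
  | not (A : Formula)
  | all (A : Formula)
  | ex (A : Formula)

namespace Formula

/-- Rename propositional variables. -/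
def rename : (ℕ → ℕ) → Formula → Formula
  | ξ, var n => var (ξ n)
  | _, bot => bot
  | ξ, and A B => and (rename ξ A) (rename ξ B)
  | ξ, or A B => or (rename ξ A) (rename ξ B)
  | ξ, imp A B => imp (rename ξ A) (rename ξ B)
  | ξ, coimp A B => coimp (rename ξ A) (rename ξ B)
  | ξ, not A => not (rename ξ A)
  | ξ, all A => all (rename (upRen ξ) A)
  | ξ, ex A => ex (rename (upRen ξ) A)

/-- `A` seen in the scope of one more variable (which does not occur in it). -/
def shift (A : Formula) : Formula := A.rename Nat.succ

/-- Lift a substitution under a binder. -/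
def up (σ : ℕ → Formula) : ℕ → Formula := scons (var 0) (fun n => (σ n).shift)

/-- Simultaneous capture-avoiding substitution. -/
def subst : (ℕ → Formula) → Formula → Formula
  | σ, var n => σ n
  | _, bot => bot
  | σ, and A B => and (subst σ A) (subst σ B)
  | σ, or A B => or (subst σ A) (subst σ B)
  | σ, imp A B => imp (subst σ A) (subst σ B)
  | σ, coimp A B => coimp (subst σ A) (subst σ B)
  | σ, not A => not (subst σ A)
  | σ, all A => all (subst (up σ) A)
  | σ, ex A => ex (subst (up σ) A)

/-- `B.inst A` is `B{α := A}`, where `α` is the variable with index `0` in `B`. -/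
def inst (B A : Formula) : Formula := B.subst (scons A var)

end Formula

/-- A pure type as a formula of natural deduction. -/
def PType.toFormula : PType → Formula
  | var n => .var n
  | and A B => .and A.toFormula B.toFormula
  | or A B => .or A.toFormula B.toFormula
  | imp A B => .imp A.toFormula B.toFormula
  | coimp A B => .coimp A.toFormula B.toFormula
  | not A => .not A.toFormula
  | all A => .all A.toFormula
  | ex A => .ex A.toFormula

/-- Derivability `Γ ⊢ A` in classical second-order natural deduction `NK`. -/
inductive NK : List Formula → Formula → Prop
  | ax {Γ : List Formula} {A : Formula} : A ∈ Γ → NK Γ A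
  | botE {Γ : List Formula} {A : Formula} : NK Γ .bot → NK Γ A
  | andI {Γ : List Formula} {A B : Formula} : NK Γ A → NK Γ B → NK Γ (.and A B)
  | andE {Γ : List Formula} {A₁ A₂ : Formula} (i : Idx) :
      NK Γ (.and A₁ A₂) → NK Γ (i.pick A₁ A₂)
  | orI {Γ : List Formula} {A₁ A₂ : Formula} (i : Idx) :
      NK Γ (i.pick A₁ A₂) → NK Γ (.or A₁ A₂)
  | orE {Γ : List Formula} {A B C : Formula} :
      NK Γ (.or A B) → NK (A :: Γ) C → NK (B :: Γ) C → NK Γ C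
  | impI {Γ : List Formula} {A B : Formula} : NK (A :: Γ) B → NK Γ (.imp A B)
  | impE {Γ : List Formula} {A B : Formula} : NK Γ (.imp A B) → NK Γ A → NK Γ B
  | coimpI {Γ : List Formula} {A B : Formula} : NK Γ (.not A) → NK Γ B → NK Γ (.coimp A B)
  | coimpE {Γ : List Formula} {A B C : Formula} :
      NK Γ (.coimp A B) → NK (B :: .not A :: Γ) C → NK Γ C
  | notI {Γ : List Formula} {A : Formula} : NK (A :: Γ) .bot → NK Γ (.not A)
  | notE {Γ : List Formula} {A : Formula} : NK Γ (.not A) → NK Γ A → NK Γ .bot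
  | allI {Γ : List Formula} {A : Formula} : NK (Γ.map Formula.shift) A → NK Γ (.all A)
  | allE {Γ : List Formula} {A B : Formula} : NK Γ (.all B) → NK Γ (B.inst A)
  | exI {Γ : List Formula} {A B : Formula} : NK Γ (B.inst A) → NK Γ (.ex B)
  | exE {Γ : List Formula} {A B : Formula} :
      NK Γ (.ex A) → NK (A :: Γ.map Formula.shift) B.shift → NK Γ B
  | lem {Γ : List Formula} {A : Formula} : NK Γ (.or A (.not A))

end PRK

/-!
**Subject reduction.** Typing is stable under renaming and under substitution of types and of
terms (`HasType.rename`, `HasType.tsubst`, `HasType.subst`), so each rewriting rule preserves types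
by inversion of the typing derivation.  The rule `η∘` discards a binder, and needs strengthening
(`HasType.of_rename`).

**Confluence.** Parallel reduction `Par`, with `η∘` included or not, lies between one-step and
many-step reduction, so it suffices that it has the diamond property on typable terms.  This is
Takahashi's argument: every typable term has a complete development to which all its parallel
reducts reduce (`Par.exists_complete_development`).  The rewriting rules without `η∘` are
orthogonal.  With `η∘` there are two critical pairs, in both of which `η∘` meets the rule for
`(λ∘ x. t) ∘ s`.  One is trivial.  The other,
`λ∘ (x:Q). s ← λ∘ (x:P). ((λ∘ (x:Q). s) ∘ x) → λ∘ (x:P). s`, is not joinable among raw terms if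
`P ≠ Q`, but `P = Q` in a typable term (`Typable.annotation_eq`).  To see that `η∘` commutes with a
reduction inside `t ∘ x`, the reducts of a weakened term must be weakened terms
(`Par.exists_of_rename_succ`); this holds because reduction creates no free variables, a fact
expressed by `Par.rename_congr` without a notion of free variable.  Subject reduction keeps all
reducts typable.

**Classical refinement.** From left to right, both affirmations `A⁺`, `A^⊕` are read as `A` and
both denials `A⁻`, `A^⊖` as `¬A`; every typing rule becomes admissible in `NK` (`HasType.toNK`).
From right to left, `⊥` is represented by `∀α.α`, and every rule of `NK` is shown to be admissible
for weak affirmations (`NK.derivable`).  The introduction rules are those of strong affirmations.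
For an elimination rule one argues by refutation: to derive `C^⊕` from `B^⊕`, assume `C^⊖` and
derive the strong denial `B⁻` (`Derivable.wp_of_sn`), whose introduction rules are dual to the
eliminations of `NK`.
-/

namespace PRK

/-! ### Substitution calculus for pure types and terms -/

theorem upRen_comp (ξ ζ : ℕ → ℕ) :
    (fun n => upRen ζ (upRen ξ n)) = upRen (fun n => ζ (ξ n)) := by
  funext n; cases n <;> rfl

theorem upRen_id : upRen (fun n => n) = fun n => n := by
  funext n; cases n <;> rfl

namespace PType

theorem rename_rename (ξ ζ : ℕ → ℕ) (A : PType) :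
    (A.rename ξ).rename ζ = A.rename (fun n => ζ (ξ n)) := by
  induction A generalizing ξ ζ <;> simp [rename, *, upRen_comp]

theorem up_upRen (ξ : ℕ → ℕ) (σ : ℕ → PType) :
    (fun n => up σ (upRen ξ n)) = up (fun n => σ (ξ n)) := by
  funext n; cases n <;> rfl

theorem subst_rename (ξ : ℕ → ℕ) (σ : ℕ → PType) (A : PType) :
    (A.rename ξ).subst σ = A.subst (fun n => σ (ξ n)) := by
  induction A generalizing ξ σ <;> simp [rename, subst, *, up_upRen]

theorem rename_up (ξ : ℕ → ℕ) (σ : ℕ → PType) :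
    (fun n => (up σ n).rename (upRen ξ)) = up (fun n => (σ n).rename ξ) := by
  funext n; cases n
  · rfl
  · simp only [up, scons, shift, rename_rename]; rfl

theorem rename_subst (ξ : ℕ → ℕ) (σ : ℕ → PType) (A : PType) :
    (A.subst σ).rename ξ = A.subst (fun n => (σ n).rename ξ) := by
  induction A generalizing ξ σ <;> simp [rename, subst, *, rename_up]

theorem shift_subst_up (σ : ℕ → PType) (A : PType) :
    A.shift.subst (up σ) = (A.subst σ).shift := by
  simp only [shift, subst_rename, rename_subst]; rfl

theorem up_subst (σ τ : ℕ → PType) :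
    (fun n => (up σ n).subst (up τ)) = up (fun n => (σ n).subst τ) := by
  funext n; cases n
  · rfl
  · exact shift_subst_up τ _

theorem subst_subst (σ τ : ℕ → PType) (A : PType) :
    (A.subst σ).subst τ = A.subst (fun n => (σ n).subst τ) := by
  induction A generalizing σ τ <;> simp [subst, *, up_subst]

theorem up_var : up var = var := by
  funext n; cases n <;> rfl

theorem subst_var (A : PType) : A.subst var = A := by
  induction A <;> simp [subst, *, up_var]

theorem rename_eq_subst (ξ : ℕ → ℕ) (A : PType) : A.rename ξ = A.subst (fun n => var (ξ n)) := by
  rw [← subst_var (A.rename ξ), subst_rename]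

theorem shift_eq_subst (A : PType) : A.shift = A.subst (fun n => var (n + 1)) :=
  rename_eq_subst _ _

theorem shift_inst (A B : PType) : B.shift.inst A = B := by
  simp only [inst, shift, subst_rename]; exact subst_var B

theorem scons_subst (σ : ℕ → PType) (A : PType) :
    (fun n => (scons A var n).subst σ) = fun n => (up σ n).subst (scons (A.subst σ) var) := by
  funext n; cases n
  · rfl
  · exact (shift_inst _ _).symm

theorem inst_subst (σ : ℕ → PType) (A B : PType) :
    (B.inst A).subst σ = (B.subst (up σ)).inst (A.subst σ) := by
  simp only [inst, subst_subst, scons_subst]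

end PType

namespace Ty

theorem subst_subst (σ τ : ℕ → PType) (P : Ty) :
    (P.subst σ).subst τ = P.subst (fun n => (σ n).subst τ) := by
  cases P <;> simp [subst, map, PType.subst_subst]

theorem subst_var (P : Ty) : P.subst PType.var = P := by
  cases P <;> simp [subst, map, PType.subst_var]

theorem shift_eq_subst (P : Ty) : P.shift = P.subst (fun n => PType.var (n + 1)) := by
  cases P <;> simp [shift, subst, map, PType.shift_eq_subst]

theorem shift_subst_up (σ : ℕ → PType) (P : Ty) :
    P.shift.subst (PType.up σ) = (P.subst σ).shift := by
  cases P <;> simp [shift, subst, map, PType.shift_subst_up]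

theorem shift_inst (A : PType) (P : Ty) : P.shift.subst (scons A PType.var) = P := by
  rw [shift_eq_subst, subst_subst]; exact subst_var P

end Ty

theorem Idx.pick_apply {α β : Type} (f : α → β) (i : Idx) (a b : α) :
    f (i.pick a b) = i.pick (f a) (f b) := by
  cases i <;> rfl

namespace Tm

theorem rename_rename (ξ ζ : ℕ → ℕ) (t : Tm) :
    (t.rename ξ).rename ζ = t.rename (fun n => ζ (ξ n)) := by
  induction t generalizing ξ ζ <;> simp [rename, *, upRen_comp]

theorem rename_id (t : Tm) : t.rename (fun n => n) = t := by
  induction t <;> simp [rename, *, upRen_id]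

theorem tsubst_tsubst (σ τ : ℕ → PType) (t : Tm) :
    (t.tsubst σ).tsubst τ = t.tsubst (fun n => (σ n).subst τ) := by
  induction t generalizing σ τ <;>
    simp [tsubst, *, PType.up_subst, Ty.subst_subst, PType.subst_subst]

theorem tsubst_var (t : Tm) : t.tsubst PType.var = t := by
  induction t <;> simp [tsubst, *, PType.up_var, Ty.subst_var, PType.subst_var]

theorem tsubst_rename (ξ : ℕ → ℕ) (σ : ℕ → PType) (t : Tm) :
    (t.rename ξ).tsubst σ = (t.tsubst σ).rename ξ := by
  induction t generalizing ξ σ <;> simp [tsubst, rename, *]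

theorem tshift_rename (ξ : ℕ → ℕ) (t : Tm) : (t.rename ξ).tshift = t.tshift.rename ξ :=
  tsubst_rename _ _ _

theorem tshift_tsubst_up (σ : ℕ → PType) (t : Tm) :
    t.tshift.tsubst (PType.up σ) = (t.tsubst σ).tshift := by
  simp only [tshift, tsubst_tsubst]
  congr 1
  funext n
  exact PType.shift_eq_subst _

theorem tshift_tinst (A : PType) (t : Tm) : t.tshift.tinst A = t := by
  simp only [tshift, tinst, tsubst_tsubst]; exact tsubst_var t

theorem up_upRen (ξ : ℕ → ℕ) (σ : ℕ → Tm) :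
    (fun n => up σ (upRen ξ n)) = up (fun n => σ (ξ n)) := by
  funext n; cases n <;> rfl

theorem upT_comp (ξ : ℕ → ℕ) (σ : ℕ → Tm) :
    (fun n => upT σ (ξ n)) = upT (fun n => σ (ξ n)) := rfl

theorem subst_rename (ξ : ℕ → ℕ) (σ : ℕ → Tm) (t : Tm) :
    (t.rename ξ).subst σ = t.subst (fun n => σ (ξ n)) := by
  induction t generalizing ξ σ <;> simp [rename, subst, *, up_upRen, upT_comp]

theorem rename_up (ξ : ℕ → ℕ) (σ : ℕ → Tm) :
    (fun n => (up σ n).rename (upRen ξ)) = up (fun n => (σ n).rename ξ) := by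
  funext n; cases n
  · rfl
  · simp only [up, scons, rename_rename]; rfl

theorem rename_upT (ξ : ℕ → ℕ) (σ : ℕ → Tm) :
    (fun n => (upT σ n).rename ξ) = upT (fun n => (σ n).rename ξ) := by
  funext n; simp only [upT, tshift_rename]

theorem rename_subst (ξ : ℕ → ℕ) (σ : ℕ → Tm) (t : Tm) :
    (t.subst σ).rename ξ = t.subst (fun n => (σ n).rename ξ) := by
  induction t generalizing ξ σ <;> simp [rename, subst, *, rename_up, rename_upT]

theorem tsubst_up (τ : ℕ → PType) (σ : ℕ → Tm) :
    (fun n => (up σ n).tsubst τ) = up (fun n => (σ n).tsubst τ) := by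
  funext n; cases n
  · rfl
  · exact tsubst_rename _ _ _

theorem upT_up (σ : ℕ → Tm) : upT (up σ) = up (upT σ) :=
  tsubst_up _ _

theorem tsubst_upT (τ : ℕ → PType) (σ : ℕ → Tm) :
    (fun n => (upT σ n).tsubst (PType.up τ)) = upT (fun n => (σ n).tsubst τ) := by
  funext n; exact tshift_tsubst_up _ _

theorem tsubst_subst (τ : ℕ → PType) (σ : ℕ → Tm) (t : Tm) :
    (t.subst σ).tsubst τ = (t.tsubst τ).subst (fun n => (σ n).tsubst τ) := by
  induction t generalizing τ σ <;> simp [tsubst, subst, *, tsubst_up, tsubst_upT]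

theorem up_subst (σ τ : ℕ → Tm) :
    (fun n => (up σ n).subst (up τ)) = up (fun n => (σ n).subst τ) := by
  funext n; cases n
  · rfl
  · simp only [up, scons, subst_rename, rename_subst]

theorem upT_subst (σ τ : ℕ → Tm) :
    (fun n => (upT σ n).subst (upT τ)) = upT (fun n => (σ n).subst τ) := by
  funext n
  exact (tsubst_subst _ _ _).symm

theorem subst_subst (σ τ : ℕ → Tm) (t : Tm) :
    (t.subst σ).subst τ = t.subst (fun n => (σ n).subst τ) := by
  induction t generalizing σ τ <;> simp [subst, *, up_subst, upT_subst]

theorem up_var : up var = var := by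
  funext n; cases n <;> rfl

theorem upT_var : upT var = var := rfl

theorem subst_var (t : Tm) : t.subst var = t := by
  induction t <;> simp [subst, *, up_var, upT_var]

theorem rename_succ_inst (t s : Tm) : (t.rename Nat.succ).inst s = t := by
  simp only [inst, subst_rename]; exact subst_var t

theorem rename_upRen_succ_inst (t : Tm) : (t.rename (upRen Nat.succ)).inst (var 0) = t := by
  simp only [inst, subst_rename]
  convert subst_var t using 2
  funext n; cases n <;> rfl

theorem rename_succ_rename_pred (t : Tm) : (t.rename Nat.succ).rename Nat.pred = t := by
  rw [rename_rename]; exact rename_id t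

theorem rename_succ_injective : Function.Injective (rename Nat.succ) :=
  Function.LeftInverse.injective rename_succ_rename_pred

theorem rename_succ_upRen (ξ : ℕ → ℕ) (t : Tm) :
    (t.rename Nat.succ).rename (upRen ξ) = (t.rename ξ).rename Nat.succ := by
  simp only [rename_rename]; rfl

theorem rename_succ_up (σ : ℕ → Tm) (t : Tm) :
    (t.rename Nat.succ).subst (up σ) = (t.subst σ).rename Nat.succ := by
  simp only [subst_rename, rename_subst]; rfl

/-! Renaming and both substitutions commute with the instantiations used in the rewriting rules. -/

theorem rename_inst (ξ : ℕ → ℕ) (t s : Tm) :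
    (t.inst s).rename ξ = (t.rename (upRen ξ)).inst (s.rename ξ) := by
  simp only [inst, rename_subst, subst_rename]
  congr 1; funext n; cases n <;> rfl

theorem rename_inst₂ (ξ : ℕ → ℕ) (u t s : Tm) :
    (u.inst₂ t s).rename ξ = (u.rename (upRen (upRen ξ))).inst₂ (t.rename ξ) (s.rename ξ) := by
  simp only [inst₂, rename_subst, subst_rename]
  congr 1; funext n; rcases n with _ | _ | n <;> rfl

theorem rename_tinst (ξ : ℕ → ℕ) (t : Tm) (A : PType) :
    (t.tinst A).rename ξ = (t.rename ξ).tinst A :=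
  (tsubst_rename _ _ _).symm

theorem subst_inst (σ : ℕ → Tm) (t s : Tm) :
    (t.inst s).subst σ = (t.subst (up σ)).inst (s.subst σ) := by
  simp only [inst, subst_subst]
  congr 1; funext n; cases n
  · rfl
  · exact (rename_succ_inst _ _).symm

theorem subst_inst₂ (σ : ℕ → Tm) (u t s : Tm) :
    (u.inst₂ t s).subst σ = (u.subst (up (up σ))).inst₂ (t.subst σ) (s.subst σ) := by
  simp only [inst₂, subst_subst]
  congr 1; funext n; rcases n with _ | _ | n
  · rfl
  · rfl
  · simp only [up, scons, subst_rename]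
    exact (subst_var _).symm

theorem subst_tinst (σ : ℕ → Tm) (t : Tm) (A : PType) :
    (t.tinst A).subst σ = (t.subst (upT σ)).tinst A := by
  simp only [tinst, tsubst_subst]
  congr 1; funext n; exact (tshift_tinst A _).symm

theorem tsubst_inst (τ : ℕ → PType) (t s : Tm) :
    (t.inst s).tsubst τ = (t.tsubst τ).inst (s.tsubst τ) := by
  simp only [inst, tsubst_subst]
  congr 1; funext n; cases n <;> rfl

theorem tsubst_inst₂ (τ : ℕ → PType) (u t s : Tm) :
    (u.inst₂ t s).tsubst τ = (u.tsubst τ).inst₂ (t.tsubst τ) (s.tsubst τ) := by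
  simp only [inst₂, tsubst_subst]
  congr 1; funext n; rcases n with _ | _ | n <;> rfl

theorem tsubst_tinst (τ : ℕ → PType) (t : Tm) (A : PType) :
    (t.tinst A).tsubst τ = (t.tsubst (PType.up τ)).tinst (A.subst τ) := by
  simp only [tinst, tsubst_tsubst, PType.scons_subst]

end Tm

/-! ### Subject reduction -/

theorem getElem?_cons_upRen {Γ Δ : Ctx} {ξ : ℕ → ℕ}
    (h : ∀ n Q, Γ[n]? = some Q → Δ[ξ n]? = some Q) (P : Ty) :
    ∀ n Q, (P :: Γ)[n]? = some Q → (P :: Δ)[upRen ξ n]? = some Q := by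
  intro n Q hn
  cases n with
  | zero => simpa [upRen, scons] using hn
  | succ n => simpa [upRen, scons] using h n Q (by simpa using hn)

theorem getElem?_shift {Γ Δ : Ctx} {ξ : ℕ → ℕ}
    (h : ∀ n Q, Γ[n]? = some Q → Δ[ξ n]? = some Q) :
    ∀ n Q, Γ.shift[n]? = some Q → Δ.shift[ξ n]? = some Q := by
  intro n Q hn
  simp only [Ctx.shift, List.getElem?_map, Option.map_eq_some_iff] at hn ⊢
  obtain ⟨R, hR, rfl⟩ := hn
  exact ⟨R, h n R hR, rfl⟩

theorem HasType.rename {Γ : Ctx} {t : Tm} {P : Ty} (h : HasType Γ t P) :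
    ∀ {Δ : Ctx} {ξ : ℕ → ℕ}, (∀ n Q, Γ[n]? = some Q → Δ[ξ n]? = some Q) →
      HasType Δ (t.rename ξ) P := by
  induction h with
  | ax h => intro Δ ξ H; exact .ax (H _ _ h)
  | _ =>
    intro Δ ξ H
    rw [Tm.rename]
    constructor <;>
      first
        | assumption
        | (rename_i ih; exact ih H)
        | (rename_i ih _; exact ih H)
        | (rename_i ih _ _; exact ih H)
        | (rename_i ih; exact ih (getElem?_cons_upRen H _))
        | (rename_i ih _; exact ih (getElem?_cons_upRen H _))
        | (rename_i ih; exact ih (getElem?_shift H))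
        | (rename_i ih; exact ih (getElem?_cons_upRen (getElem?_cons_upRen H _) _))
        | (rename_i ih; exact ih (getElem?_cons_upRen (getElem?_shift H) _))

theorem HasType.weaken {Γ : Ctx} {t : Tm} {P : Ty} (h : HasType Γ t P) (Q : Ty) :
    HasType (Q :: Γ) (t.rename Nat.succ) P :=
  h.rename (fun n R hn => by simpa using hn)

theorem getElem?_cons_of_upRen {Γ Δ : Ctx} {ξ : ℕ → ℕ}
    (h : ∀ n Q, Δ[ξ n]? = some Q → Γ[n]? = some Q) (P : Ty) :
    ∀ n Q, (P :: Δ)[upRen ξ n]? = some Q → (P :: Γ)[n]? = some Q := by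
  intro n Q hn
  cases n with
  | zero => simpa [upRen, scons] using hn
  | succ n => simpa using h n Q (by simpa [upRen, scons] using hn)

theorem getElem?_of_shift {Γ Δ : Ctx} {ξ : ℕ → ℕ}
    (h : ∀ n Q, Δ[ξ n]? = some Q → Γ[n]? = some Q) :
    ∀ n Q, Δ.shift[ξ n]? = some Q → Γ.shift[n]? = some Q := by
  intro n Q hn
  simp only [Ctx.shift, List.getElem?_map, Option.map_eq_some_iff] at hn ⊢
  obtain ⟨R, hR, rfl⟩ := hn
  exact ⟨R, h n R hR, rfl⟩

/-- Strengthening: only the variables in the range of the renaming matter for the typing of a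
renamed term.  The rule `η∘` needs it, since it discards a binder. -/
theorem HasType.of_rename {t : Tm} : ∀ {Γ Δ : Ctx} {ξ : ℕ → ℕ} {P : Ty},
    HasType Δ (t.rename ξ) P → (∀ n Q, Δ[ξ n]? = some Q → Γ[n]? = some Q) → HasType Γ t P := by
  induction t with
  | var n => intro Γ Δ ξ P h H; cases h with | ax h => exact .ax (H _ _ h)
  | _ =>
    intro Γ Δ ξ P h H
    have H₁ := getElem?_cons_of_upRen H
    have H₂ := fun P => getElem?_cons_of_upRen (H₁ P)
    have H₃ := getElem?_of_shift H
    have H₄ := getElem?_cons_of_upRen H₃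
    rw [Tm.rename] at h
    cases h <;> constructor <;> solve_by_elim

theorem HasType.strengthen {Γ : Ctx} {t : Tm} {P Q : Ty}
    (h : HasType (Q :: Γ) (t.rename Nat.succ) P) : HasType Γ t P :=
  h.of_rename (fun n R hn => by simpa using hn)

theorem map_subst_shift (σ : ℕ → PType) (Γ : Ctx) :
    Ctx.shift (Γ.map (Ty.subst σ)) = Γ.shift.map (Ty.subst (PType.up σ)) := by
  simp [Ctx.shift, Ty.shift_subst_up]

theorem HasType.tsubst {Γ : Ctx} {t : Tm} {P : Ty} (h : HasType Γ t P) :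
    ∀ σ : ℕ → PType, HasType (Γ.map (Ty.subst σ)) (t.tsubst σ) (P.subst σ) := by
  induction h with
  | ax h => intro σ; exact .ax (by simp [h])
  | projPos i _ ih =>
    intro σ
    have := HasType.projPos i (ih σ)
    rwa [← Idx.pick_apply (PType.subst σ)] at this
  | projNeg i _ ih =>
    intro σ
    have := HasType.projNeg i (ih σ)
    rwa [← Idx.pick_apply (PType.subst σ)] at this
  | injPos i _ ih =>
    intro σ
    refine HasType.injPos i ?_
    rw [← Idx.pick_apply (PType.subst σ)]
    exact ih σ
  | injNeg i _ ih =>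
    intro σ
    refine HasType.injNeg i ?_
    rw [← Idx.pick_apply (PType.subst σ)]
    exact ih σ
  | tlamPos _ ih =>
    intro σ
    refine .tlamPos ?_
    rw [map_subst_shift]; exact ih _
  | tlamNeg _ ih =>
    intro σ
    refine .tlamNeg ?_
    rw [map_subst_shift]; exact ih _
  | tappPos _ ih =>
    rename_i A _ _
    intro σ
    have := HasType.tappPos (A := A.subst σ) (ih σ)
    simpa only [Tm.tsubst, Ty.subst, Ty.map, PType.inst_subst] using this
  | tappNeg _ ih =>
    rename_i A _ _
    intro σ
    have := HasType.tappNeg (A := A.subst σ) (ih σ)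
    simpa only [Tm.tsubst, Ty.subst, Ty.map, PType.inst_subst] using this
  | packPos _ ih =>
    intro σ
    refine HasType.packPos ?_
    have := ih σ
    simpa only [Tm.tsubst, Ty.subst, Ty.map, PType.inst_subst] using this
  | packNeg _ ih =>
    intro σ
    refine HasType.packNeg ?_
    have := ih σ
    simpa only [Tm.tsubst, Ty.subst, Ty.map, PType.inst_subst] using this
  | unpackPos _ _ ih₁ ih₂ =>
    intro σ
    refine HasType.unpackPos (ih₁ σ) ?_
    rw [map_subst_shift, ← Ty.shift_subst_up]
    exact ih₂ (PType.up σ)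
  | unpackNeg _ _ ih₁ ih₂ =>
    intro σ
    refine HasType.unpackNeg (ih₁ σ) ?_
    rw [map_subst_shift, ← Ty.shift_subst_up]
    exact ih₂ (PType.up σ)
  | _ =>
    intro σ
    constructor <;>
      first
        | (rename_i ih; exact ih σ)
        | (rename_i ih _; exact ih σ)
        | (rename_i ih _ _; exact ih σ)

theorem Ctx.map_subst_succ (Γ : Ctx) :
    Γ.map (Ty.subst fun n => PType.var (n + 1)) = Γ.shift :=
  List.map_congr_left fun P _ => (Ty.shift_eq_subst P).symm

theorem HasType.tshift {Γ : Ctx} {t : Tm} {P : Ty} (h : HasType Γ t P) :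
    HasType Γ.shift t.tshift P.shift := by
  rw [← Ctx.map_subst_succ, Ty.shift_eq_subst]
  exact h.tsubst _

theorem Ctx.shift_inst (A : PType) (Γ : Ctx) :
    Γ.shift.map (Ty.subst (scons A PType.var)) = Γ := by
  simp [Ctx.shift, Function.comp_def, Ty.shift_inst]

theorem HasType.tinst {Γ : Ctx} {t : Tm} {P : Ty} (h : HasType Γ.shift t P) (A : PType) :
    HasType Γ (t.tinst A) (P.subst (scons A PType.var)) := by
  have := h.tsubst (scons A PType.var)
  rwa [Ctx.shift_inst] at this

theorem HasType.up {Γ Δ : Ctx} {σ : ℕ → Tm}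
    (h : ∀ n Q, Γ[n]? = some Q → HasType Δ (σ n) Q) (P : Ty) :
    ∀ n Q, (P :: Γ)[n]? = some Q → HasType (P :: Δ) (Tm.up σ n) Q := by
  intro n Q hn
  cases n with
  | zero => exact .ax (by simpa using hn)
  | succ n => exact (h n Q (by simpa using hn)).weaken P

theorem HasType.upT {Γ Δ : Ctx} {σ : ℕ → Tm}
    (h : ∀ n Q, Γ[n]? = some Q → HasType Δ (σ n) Q) :
    ∀ n Q, Γ.shift[n]? = some Q → HasType Δ.shift (Tm.upT σ n) Q := by
  intro n Q hn
  simp only [Ctx.shift, List.getElem?_map, Option.map_eq_some_iff] at hn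
  obtain ⟨R, hR, rfl⟩ := hn
  exact (h n R hR).tshift

theorem HasType.subst {Γ : Ctx} {t : Tm} {P : Ty} (h : HasType Γ t P) :
    ∀ {Δ : Ctx} {σ : ℕ → Tm}, (∀ n Q, Γ[n]? = some Q → HasType Δ (σ n) Q) →
      HasType Δ (t.subst σ) P := by
  induction h with
  | ax h => intro Δ σ H; exact H _ _ h
  | _ =>
    intro Δ σ H
    rw [Tm.subst]
    constructor <;>
      first
        | assumption
        | (rename_i ih; exact ih H)
        | (rename_i ih _; exact ih H)
        | (rename_i ih _ _; exact ih H)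
        | (rename_i ih; exact ih (HasType.up H _))
        | (rename_i ih _; exact ih (HasType.up H _))
        | (rename_i ih; exact ih (HasType.upT H))
        | (rename_i ih; exact ih (HasType.up (HasType.up H _) _))
        | (rename_i ih; exact ih (HasType.up (HasType.upT H) _))

theorem HasType.inst {Γ : Ctx} {t s : Tm} {P Q : Ty} (ht : HasType (P :: Γ) t Q)
    (hs : HasType Γ s P) : HasType Γ (t.inst s) Q := by
  refine ht.subst fun n R hn => ?_
  cases n with
  | zero => obtain rfl : P = R := by simpa using hn
            exact hs
  | succ n => exact .ax (by simpa using hn)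

theorem HasType.inst₂ {Γ : Ctx} {u t s : Tm} {P Q R : Ty} (hu : HasType (Q :: P :: Γ) u R)
    (ht : HasType Γ t P) (hs : HasType Γ s Q) : HasType Γ (u.inst₂ t s) R := by
  refine hu.subst fun n S hn => ?_
  rcases n with _ | _ | n
  · obtain rfl : Q = S := by simpa using hn
    exact hs
  · obtain rfl : P = S := by simpa using hn
    exact ht
  · exact .ax (by simpa using hn)

theorem HasType.gabsPos {Γ : Ctx} {t s : Tm} {A : PType} (ht : HasType Γ t (.wp A))
    (hs : HasType Γ s (.wn A)) (Q : Ty) : HasType Γ (.gabsPos Q t s) Q :=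
  .abs (.cappPos ht hs) (.cappNeg hs ht)

theorem HasType.of_rule {Γ : Ctx} {t s : Tm} {P : Ty} (h : HasType Γ t P) (r : Rule t s) :
    HasType Γ s P := by
  cases r with
  | clas =>
    cases h with
    | cappPos h₁ h₂ => cases h₁ with | clamPos h₁ => exact h₁.inst h₂
    | cappNeg h₁ h₂ => cases h₁ with | clamNeg h₁ => exact h₁.inst h₂
  | proj ε i =>
    cases h with
    | projPos _ h => cases h; cases i <;> assumption
    | projNeg _ h => cases h; cases i <;> assumption
  | caseOf ε i =>
    cases h with
    | casePos h h₁ h₂ =>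
      cases h with | injPos _ h => cases i
                                   · exact h₁.inst h
                                   · exact h₂.inst h
    | caseNeg h h₁ h₂ =>
      cases h with | injNeg _ h => cases i
                                   · exact h₁.inst h
                                   · exact h₂.inst h
  | lam =>
    cases h with
    | appPos h₁ h₂ => cases h₁ with | lamPos h₁ => exact h₁.inst h₂
    | appNeg h₁ h₂ => cases h₁ with | lamNeg h₁ => exact h₁.inst h₂
  | colam =>
    cases h with
    | colamPos h₁ h₂ => cases h₁ with | copairPos h h' => exact h₂.inst₂ h h'
    | colamNeg h₁ h₂ => cases h₁ with | copairNeg h h' => exact h₂.inst₂ h h'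
  | neg =>
    cases h with
    | negEPos h => cases h; assumption
    | negENeg h => cases h; assumption
  | tlam ε t A =>
    cases h with
    | tappPos h => cases h with | tlamPos h => exact h.tinst A
    | tappNeg h => cases h with | tlamNeg h => exact h.tinst A
  | unpack ε A =>
    cases h with
    | unpackPos h₁ h₂ =>
      cases h₁ with
      | packPos h₁ =>
        have h₂ := h₂.tsubst (scons A PType.var)
        rw [List.map_cons, Ctx.shift_inst, Ty.shift_inst] at h₂
        exact h₂.inst h₁
    | unpackNeg h₁ h₂ =>
      cases h₁ with
      | packNeg h₁ =>
        have h₂ := h₂.tsubst (scons A PType.var)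
        rw [List.map_cons, Ctx.shift_inst, Ty.shift_inst] at h₂
        exact h₂.inst h₁
  | absAnd i =>
    cases h with
    | abs h₁ h₂ => cases h₁ with | pairPos => cases h₂ with | injNeg _ h =>
      cases i <;> exact HasType.gabsPos (by assumption) h _
  | absOr i =>
    cases h with
    | abs h₁ h₂ => cases h₁ with | injPos _ h => cases h₂ with | pairNeg =>
      cases i <;> exact HasType.gabsPos h (by assumption) _
  | absImp =>
    cases h with
    | abs h₁ h₂ => cases h₁ with | lamPos h => cases h₂ with | copairNeg h₁ h₂ =>
      exact (h.inst h₁).gabsPos h₂ _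
  | absCoimp =>
    cases h with
    | abs h₁ h₂ => cases h₁ with | copairPos h₁ h₃ => cases h₂ with | lamNeg h =>
      exact h₃.gabsPos (h.inst h₁) _
  | absNeg =>
    cases h with
    | abs h₁ h₂ => cases h₁ with | negIPos h₁ => cases h₂ with | negINeg h₂ =>
      exact h₂.gabsPos h₁ _
  | absAll Q A =>
    cases h with
    | abs h₁ h₂ => cases h₁ with | tlamPos h₁ => cases h₂ with | packNeg h₂ =>
      exact (h₁.tinst A).gabsPos h₂ _
  | absEx Q A =>
    cases h with
    | abs h₁ h₂ => cases h₁ with | packPos h₁ => cases h₂ with | tlamNeg h₂ =>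
      exact h₁.gabsPos (h₂.tinst A) _

theorem HasType.of_etaRule {Γ : Ctx} {t s : Tm} {P : Ty} (h : HasType Γ t P)
    (r : EtaRule t s) : HasType Γ s P := by
  cases r
  cases h with
  | clamPos h => cases h with | cappPos h => exact h.strengthen
  | clamNeg h => cases h with | cappNeg h => exact h.strengthen

theorem HasType.of_step {η : Bool} {t s : Tm} (r : Step η t s) :
    ∀ {Γ : Ctx} {P : Ty}, HasType Γ t P → HasType Γ s P := by
  induction r with
  | root r =>
    intro Γ P h
    rcases r with r | ⟨-, r⟩
    · exact h.of_rule r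
    · exact h.of_etaRule r
  | _ =>
    intro Γ P h
    cases h <;> constructor <;> solve_by_elim

/-! ### Parallel reduction -/

/-- Parallel reduction: contracts any set of redexes that are present in the term at once.  The
rule `η∘` takes part only if `η = true`; its left-hand side is given through an equation, so that
case analysis applies to it. -/
inductive Par (η : Bool) : Tm → Tm → Prop
  | rClas {ε : Sign} {P : Ty} {t t' s s' : Tm} : Par η t t' → Par η s s' →
      Par η (.capp ε (.clam ε P t) s) (t'.inst s')
  | rProj {ε : Sign} {i : Idx} {t t' s s' : Tm} : Par η t t' → Par η s s' →
      Par η (.proj ε i (.pair ε t s)) (i.pick t' s')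
  | rCase {ε : Sign} {i : Idx} {t t' : Tm} {P : Ty} {s s' : Tm} {Q : Ty} {u u' : Tm} :
      Par η t t' → Par η s s' → Par η u u' →
      Par η (.caseOf ε (.inj ε i t) P s Q u) ((i.pick s' u').inst t')
  | rLam {ε : Sign} {P : Ty} {t t' s s' : Tm} : Par η t t' → Par η s s' →
      Par η (.app ε (.lam ε P t) s) (t'.inst s')
  | rColam {ε : Sign} {t t' s s' : Tm} {P Q : Ty} {u u' : Tm} :
      Par η t t' → Par η s s' → Par η u u' →
      Par η (.colam ε (.copair ε t s) P Q u) (u'.inst₂ t' s')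
  | rNeg {ε : Sign} {t t' : Tm} : Par η t t' → Par η (.negE ε (.negI ε t)) t'
  | rTlam {ε : Sign} {t t' : Tm} {A : PType} : Par η t t' →
      Par η (.tapp ε (.tlam ε t) A) (t'.tinst A)
  | rUnpack {ε : Sign} {A : PType} {t t' : Tm} {P : Ty} {s s' : Tm} :
      Par η t t' → Par η s s' → Par η (.unpack ε (.pack ε A t) P s) ((s'.tinst A).inst t')
  | rAnd {i : Idx} {Q : Ty} {t t' s s' u u' : Tm} : Par η t t' → Par η s s' → Par η u u' →
      Par η (.sabs Q (.pair .pos t s) (.inj .neg i u)) (.gabsPos Q (i.pick t' s') u')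
  | rOr {i : Idx} {Q : Ty} {t t' s s' u u' : Tm} : Par η t t' → Par η s s' → Par η u u' →
      Par η (.sabs Q (.inj .pos i t) (.pair .neg s u)) (.gabsPos Q t' (i.pick s' u'))
  | rImp {Q P : Ty} {t t' s s' u u' : Tm} : Par η t t' → Par η s s' → Par η u u' →
      Par η (.sabs Q (.lam .pos P t) (.copair .neg s u)) (.gabsPos Q (t'.inst s') u')
  | rCoimp {Q P : Ty} {t t' s s' u u' : Tm} : Par η t t' → Par η s s' → Par η u u' →
      Par η (.sabs Q (.copair .pos t s) (.lam .neg P u)) (.gabsPos Q s' (u'.inst t'))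
  | rNot {Q : Ty} {t t' s s' : Tm} : Par η t t' → Par η s s' →
      Par η (.sabs Q (.negI .pos t) (.negI .neg s)) (.gabsNeg Q t' s')
  | rAll {Q : Ty} {A : PType} {t t' s s' : Tm} : Par η t t' → Par η s s' →
      Par η (.sabs Q (.tlam .pos t) (.pack .neg A s)) (.gabsPos Q (t'.tinst A) s')
  | rEx {Q : Ty} {A : PType} {t t' s s' : Tm} : Par η t t' → Par η s s' →
      Par η (.sabs Q (.pack .pos A t) (.tlam .neg s)) (.gabsPos Q t' (s'.tinst A))
  | var {n : ℕ} : Par η (.var n) (.var n)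
  | sabs {P : Ty} {t t' s s' : Tm} : Par η t t' → Par η s s' →
      Par η (.sabs P t s) (.sabs P t' s')
  | clam {ε : Sign} {P : Ty} {t t' : Tm} : Par η t t' → Par η (.clam ε P t) (.clam ε P t')
  | capp {ε : Sign} {t t' s s' : Tm} : Par η t t' → Par η s s' →
      Par η (.capp ε t s) (.capp ε t' s')
  | pair {ε : Sign} {t t' s s' : Tm} : Par η t t' → Par η s s' →
      Par η (.pair ε t s) (.pair ε t' s')
  | proj {ε : Sign} {i : Idx} {t t' : Tm} : Par η t t' → Par η (.proj ε i t) (.proj ε i t')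
  | inj {ε : Sign} {i : Idx} {t t' : Tm} : Par η t t' → Par η (.inj ε i t) (.inj ε i t')
  | caseOf {ε : Sign} {t t' : Tm} {P : Ty} {s s' : Tm} {Q : Ty} {u u' : Tm} :
      Par η t t' → Par η s s' → Par η u u' →
      Par η (.caseOf ε t P s Q u) (.caseOf ε t' P s' Q u')
  | lam {ε : Sign} {P : Ty} {t t' : Tm} : Par η t t' → Par η (.lam ε P t) (.lam ε P t')
  | app {ε : Sign} {t t' s s' : Tm} : Par η t t' → Par η s s' →
      Par η (.app ε t s) (.app ε t' s')
  | copair {ε : Sign} {t t' s s' : Tm} : Par η t t' → Par η s s' →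
      Par η (.copair ε t s) (.copair ε t' s')
  | colam {ε : Sign} {t t' : Tm} {P Q : Ty} {s s' : Tm} : Par η t t' → Par η s s' →
      Par η (.colam ε t P Q s) (.colam ε t' P Q s')
  | negI {ε : Sign} {t t' : Tm} : Par η t t' → Par η (.negI ε t) (.negI ε t')
  | negE {ε : Sign} {t t' : Tm} : Par η t t' → Par η (.negE ε t) (.negE ε t')
  | tlam {ε : Sign} {t t' : Tm} : Par η t t' → Par η (.tlam ε t) (.tlam ε t')
  | tapp {ε : Sign} {t t' : Tm} {A : PType} : Par η t t' → Par η (.tapp ε t A) (.tapp ε t' A)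
  | pack {ε : Sign} {A : PType} {t t' : Tm} : Par η t t' → Par η (.pack ε A t) (.pack ε A t')
  | unpack {ε : Sign} {t t' : Tm} {P : Ty} {s s' : Tm} : Par η t t' → Par η s s' →
      Par η (.unpack ε t P s) (.unpack ε t' P s')
  | rEta {ε : Sign} {P : Ty} {u t t' : Tm} : η = true →
      u = .capp ε (t.rename Nat.succ) (.var 0) → Par η t t' → Par η (.clam ε P u) t'

namespace Par

variable {η : Bool}

theorem refl (t : Tm) : Par η t t := by
  induction t <;> constructor <;> assumption

theorem pick {t t' s s' : Tm} (i : Idx) (h₁ : Par η t t') (h₂ : Par η s s') :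
    Par η (i.pick t s) (i.pick t' s') := by
  cases i <;> assumption

theorem rename {t t' : Tm} (h : Par η t t') (ξ : ℕ → ℕ) :
    Par η (t.rename ξ) (t'.rename ξ) := by
  induction h generalizing ξ with
  | rEta hη hu _ ih =>
    subst hu
    refine rEta hη ?_ (ih ξ)
    simp only [Tm.rename, Tm.rename_succ_upRen]; rfl
  | _ =>
    simp only [Tm.rename, Tm.rename_inst, Tm.rename_inst₂, Tm.rename_tinst, Tm.gabsPos,
      Tm.gabsNeg, Idx.pick_apply (Tm.rename _)]
    constructor <;> solve_by_elim

theorem tsubst {t t' : Tm} (h : Par η t t') (σ : ℕ → PType) :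
    Par η (t.tsubst σ) (t'.tsubst σ) := by
  induction h generalizing σ with
  | rEta hη hu _ ih =>
    subst hu
    refine rEta hη ?_ (ih σ)
    simp only [Tm.tsubst, Tm.tsubst_rename]
  | _ =>
    simp only [Tm.tsubst, Tm.tsubst_inst, Tm.tsubst_inst₂, Tm.tsubst_tinst, Tm.gabsPos,
      Tm.gabsNeg, Idx.pick_apply (Tm.tsubst _)]
    constructor <;> solve_by_elim

theorem tinst {t t' : Tm} (h : Par η t t') (A : PType) : Par η (t.tinst A) (t'.tinst A) :=
  h.tsubst _

theorem up {σ τ : ℕ → Tm} (h : ∀ n, Par η (σ n) (τ n)) (n : ℕ) :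
    Par η (Tm.up σ n) (Tm.up τ n) := by
  cases n with
  | zero => exact refl _
  | succ n => exact (h n).rename _

theorem upT {σ τ : ℕ → Tm} (h : ∀ n, Par η (σ n) (τ n)) (n : ℕ) :
    Par η (Tm.upT σ n) (Tm.upT τ n) :=
  (h n).tsubst _

theorem subst {t t' : Tm} (h : Par η t t') {σ τ : ℕ → Tm} (H : ∀ n, Par η (σ n) (τ n)) :
    Par η (t.subst σ) (t'.subst τ) := by
  induction h generalizing σ τ with
  | var => exact H _
  | rEta hη hu _ ih =>
    subst hu
    refine rEta hη ?_ (ih H)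
    simp only [Tm.subst, Tm.rename_succ_up]; rfl
  | _ =>
    have H₁ := up H
    have H₂ := up H₁
    have H₃ := upT H
    have H₄ := up H₃
    simp only [Tm.subst, Tm.subst_inst, Tm.subst_inst₂, Tm.subst_tinst, Tm.upT_up,
      Tm.gabsPos, Tm.gabsNeg, Idx.pick_apply (Tm.subst _)]
    constructor <;> solve_by_elim

theorem inst {t t' s s' : Tm} (h₁ : Par η t t') (h₂ : Par η s s') :
    Par η (t.inst s) (t'.inst s') :=
  h₁.subst fun n => by cases n; exacts [h₂, refl _]

theorem inst₂ {u u' t t' s s' : Tm} (h : Par η u u') (h₁ : Par η t t') (h₂ : Par η s s') :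
    Par η (u.inst₂ t s) (u'.inst₂ t' s') :=
  h.subst fun n => by rcases n with _ | _ | n; exacts [h₂, h₁, refl _]

theorem gabsPos {t t' s s' : Tm} (Q : Ty) (h₁ : Par η t t') (h₂ : Par η s s') :
    Par η (.gabsPos Q t s) (.gabsPos Q t' s') :=
  sabs (capp h₁ h₂) (capp h₂ h₁)

theorem gabsNeg {t t' s s' : Tm} (Q : Ty) (h₁ : Par η t t') (h₂ : Par η s s') :
    Par η (.gabsNeg Q t s) (.gabsNeg Q t' s') :=
  gabsPos Q h₂ h₁

/-- Reduction creates no free variables: two renamings that act alike on a term also act alike on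
its reducts. -/
theorem rename_congr {t t' : Tm} (h : Par η t t') :
    ∀ {ξ ζ : ℕ → ℕ}, t.rename ξ = t.rename ζ → t'.rename ξ = t'.rename ζ := by
  induction h with
  | var => exact fun h => h
  | rEta hη hu _ ih =>
    subst hu
    intro ξ ζ h
    simp only [Tm.rename, Tm.rename_succ_upRen, Tm.clam.injEq, Tm.capp.injEq, true_and] at h
    exact ih (Tm.rename_succ_injective h.1)
  | _ =>
    intro ξ ζ h
    simp only [Tm.rename, Tm.rename_inst, Tm.rename_inst₂, Tm.rename_tinst, Tm.gabsPos,
      Tm.gabsNeg, Idx.pick_apply (Tm.rename _)] at h ⊢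
    grind

/-- A reduct of a weakened term is a weakened term. -/
theorem exists_of_rename_succ {t a : Tm} (h : Par η (t.rename Nat.succ) a) :
    ∃ t', a = t'.rename Nat.succ ∧ Par η t t' := by
  refine ⟨a.rename Nat.pred, ?_, ?_⟩
  · have := h.rename_congr (ξ := fun n => n) (ζ := fun n => Nat.succ (Nat.pred n))
      (by simp only [Tm.rename_rename]; rfl)
    rwa [Tm.rename_id, ← Tm.rename_rename] at this
  · have := h.rename Nat.pred
    rwa [Tm.rename_succ_rename_pred] at this

end Par

/-! ### Confluence -/

/-- The immediate subterms of a term. -/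
def Tm.children : Tm → List Tm
  | var _ => []
  | sabs _ t s => [t, s]
  | clam _ _ t => [t]
  | capp _ t s => [t, s]
  | pair _ t s => [t, s]
  | proj _ _ t => [t]
  | inj _ _ t => [t]
  | caseOf _ t _ s _ u => [t, s, u]
  | lam _ _ t => [t]
  | app _ t s => [t, s]
  | copair _ t s => [t, s]
  | colam _ t _ _ s => [t, s]
  | negI _ t => [t]
  | negE _ t => [t]
  | tlam _ t => [t]
  | tapp _ t _ => [t]
  | pack _ _ t => [t]
  | unpack _ t _ s => [t, s]

theorem Typable.of_mem_children {t u : Tm} (h : Typable t) (hu : u ∈ t.children) :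
    Typable u := by
  obtain ⟨Γ, P, h⟩ := h
  cases h <;> simp only [Tm.children, List.mem_cons, List.not_mem_nil, or_false] at hu <;>
    rcases hu with rfl | rfl | rfl <;>
    exact ⟨_, _, by assumption⟩

/-- The two annotations in a critical pair between `η∘` and the rule for `∘` agree in a typable
term. -/
theorem Typable.annotation_eq {ε : Sign} {P Q : Ty} {t s : Tm}
    (h : Typable (.clam ε P (.capp ε (.clam ε Q t) s))) : P = Q := by
  obtain ⟨Γ, R, h⟩ := h
  cases h with
  | clamPos h => cases h with | cappPos h => cases h; rfl
  | clamNeg h => cases h with | cappNeg h => cases h; rfl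

/-- Takahashi's triangle property: the parallel reducts of a typable term `t` all reduce to one
term, in which every redex of `t` has been contracted. -/
theorem Par.exists_complete_development {η : Bool} (t : Tm) (h : Typable t) :
    ∃ c, ∀ a, Par η t a → Par η a c := by
  induction hn : sizeOf t using Nat.strong_induction_on generalizing t with | _ n ih
  subst hn
  replace ih : ∀ u, sizeOf u < sizeOf t → Typable u → ∃ c, ∀ a, Par η u a → Par η a c :=
    fun u hu h => ih _ hu u h rfl
  cases t with
  | var n => exact ⟨.var n, fun a ha => by cases ha; exact .var⟩
  | sabs Q t s =>
    have ht : Typable t := h.of_mem_children (by simp [Tm.children])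
    have hs : Typable s := h.of_mem_children (by simp [Tm.children])
    by_cases hr : ∃ b, Rule (.sabs Q t s) b
    · obtain ⟨b, r⟩ := hr
      cases r with
      | absAnd i Q t₁ t₂ s =>
        obtain ⟨c₁, h₁⟩ := ih t₁ (by simp; omega) (ht.of_mem_children (by simp [Tm.children]))
        obtain ⟨c₂, h₂⟩ := ih t₂ (by simp; omega) (ht.of_mem_children (by simp [Tm.children]))
        obtain ⟨c₃, h₃⟩ := ih s (by simp; omega) (hs.of_mem_children (by simp [Tm.children]))
        refine ⟨.gabsPos Q (i.pick c₁ c₂) c₃, fun a ha => ?_⟩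
        cases ha with
        | rAnd k₁ k₂ k₃ => exact gabsPos Q (pick i (h₁ _ k₁) (h₂ _ k₂)) (h₃ _ k₃)
        | sabs k₁ k₂ =>
          cases k₁ with | pair k₁ k₃ => cases k₂ with | inj k₂ =>
            exact rAnd (h₁ _ k₁) (h₂ _ k₃) (h₃ _ k₂)
      | absOr i Q t s₁ s₂ =>
        obtain ⟨c₁, h₁⟩ := ih t (by simp; omega) (ht.of_mem_children (by simp [Tm.children]))
        obtain ⟨c₂, h₂⟩ := ih s₁ (by simp; omega) (hs.of_mem_children (by simp [Tm.children]))
        obtain ⟨c₃, h₃⟩ := ih s₂ (by simp; omega) (hs.of_mem_children (by simp [Tm.children]))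
        refine ⟨.gabsPos Q c₁ (i.pick c₂ c₃), fun a ha => ?_⟩
        cases ha with
        | rOr k₁ k₂ k₃ => exact gabsPos Q (h₁ _ k₁) (pick i (h₂ _ k₂) (h₃ _ k₃))
        | sabs k₁ k₂ =>
          cases k₁ with | inj k₁ => cases k₂ with | pair k₂ k₃ =>
            exact rOr (h₁ _ k₁) (h₂ _ k₂) (h₃ _ k₃)
      | absImp Q P t s u =>
        obtain ⟨c₁, h₁⟩ := ih t (by simp; omega) (ht.of_mem_children (by simp [Tm.children]))
        obtain ⟨c₂, h₂⟩ := ih s (by simp; omega) (hs.of_mem_children (by simp [Tm.children]))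
        obtain ⟨c₃, h₃⟩ := ih u (by simp; omega) (hs.of_mem_children (by simp [Tm.children]))
        refine ⟨.gabsPos Q (c₁.inst c₂) c₃, fun a ha => ?_⟩
        cases ha with
        | rImp k₁ k₂ k₃ => exact gabsPos Q ((h₁ _ k₁).inst (h₂ _ k₂)) (h₃ _ k₃)
        | sabs k₁ k₂ =>
          cases k₁ with | lam k₁ => cases k₂ with | copair k₂ k₃ =>
            exact rImp (h₁ _ k₁) (h₂ _ k₂) (h₃ _ k₃)
      | absCoimp Q P t s u =>
        obtain ⟨c₁, h₁⟩ := ih t (by simp; omega) (ht.of_mem_children (by simp [Tm.children]))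
        obtain ⟨c₂, h₂⟩ := ih s (by simp; omega) (ht.of_mem_children (by simp [Tm.children]))
        obtain ⟨c₃, h₃⟩ := ih u (by simp; omega) (hs.of_mem_children (by simp [Tm.children]))
        refine ⟨.gabsPos Q c₂ (c₃.inst c₁), fun a ha => ?_⟩
        cases ha with
        | rCoimp k₁ k₂ k₃ => exact gabsPos Q (h₂ _ k₂) ((h₃ _ k₃).inst (h₁ _ k₁))
        | sabs k₁ k₂ =>
          cases k₁ with | copair k₁ k₃ => cases k₂ with | lam k₂ =>
            exact rCoimp (h₁ _ k₁) (h₂ _ k₃) (h₃ _ k₂)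
      | absNeg Q t s =>
        obtain ⟨c₁, h₁⟩ := ih t (by simp; omega) (ht.of_mem_children (by simp [Tm.children]))
        obtain ⟨c₂, h₂⟩ := ih s (by simp; omega) (hs.of_mem_children (by simp [Tm.children]))
        refine ⟨.gabsNeg Q c₁ c₂, fun a ha => ?_⟩
        cases ha with
        | rNot k₁ k₂ => exact gabsNeg Q (h₁ _ k₁) (h₂ _ k₂)
        | sabs k₁ k₂ =>
          cases k₁ with | negI k₁ => cases k₂ with | negI k₂ => exact rNot (h₁ _ k₁) (h₂ _ k₂)
      | absAll Q A t s =>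
        obtain ⟨c₁, h₁⟩ := ih t (by simp; omega) (ht.of_mem_children (by simp [Tm.children]))
        obtain ⟨c₂, h₂⟩ := ih s (by simp; omega) (hs.of_mem_children (by simp [Tm.children]))
        refine ⟨.gabsPos Q (c₁.tinst A) c₂, fun a ha => ?_⟩
        cases ha with
        | rAll k₁ k₂ => exact gabsPos Q ((h₁ _ k₁).tinst A) (h₂ _ k₂)
        | sabs k₁ k₂ =>
          cases k₁ with | tlam k₁ => cases k₂ with | pack k₂ => exact rAll (h₁ _ k₁) (h₂ _ k₂)
      | absEx Q A t s =>
        obtain ⟨c₁, h₁⟩ := ih t (by simp; omega) (ht.of_mem_children (by simp [Tm.children]))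
        obtain ⟨c₂, h₂⟩ := ih s (by simp; omega) (hs.of_mem_children (by simp [Tm.children]))
        refine ⟨.gabsPos Q c₁ (c₂.tinst A), fun a ha => ?_⟩
        cases ha with
        | rEx k₁ k₂ => exact gabsPos Q (h₁ _ k₁) ((h₂ _ k₂).tinst A)
        | sabs k₁ k₂ =>
          cases k₁ with | pack k₁ => cases k₂ with | tlam k₂ => exact rEx (h₁ _ k₁) (h₂ _ k₂)
    · obtain ⟨c₁, h₁⟩ := ih t (by simp; omega) ht
      obtain ⟨c₂, h₂⟩ := ih s (by simp) hs
      refine ⟨.sabs Q c₁ c₂, fun a ha => ?_⟩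
      cases ha with
      | sabs k₁ k₂ => exact sabs (h₁ _ k₁) (h₂ _ k₂)
      | _ => exact (hr ⟨_, by constructor⟩).elim
  | clam ε P t =>
    have ht : Typable t := h.of_mem_children (by simp [Tm.children])
    by_cases hr : η = true ∧ ∃ v, t = .capp ε (Tm.rename Nat.succ v) (.var 0)
    · obtain ⟨hη, v, rfl⟩ := hr
      obtain ⟨c, hc⟩ := ih (v.rename Nat.succ) (by simp; omega)
        (ht.of_mem_children (by simp [Tm.children]))
      -- The complete development of `v` is read off from that of the subterm `v.rename succ`.
      have key : ∀ b, Par η v b → Par η b (c.rename Nat.pred) := by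
        intro b hb
        have := (hc _ (hb.rename Nat.succ)).rename Nat.pred
        rwa [Tm.rename_succ_rename_pred] at this
      refine ⟨c.rename Nat.pred, fun a ha => ?_⟩
      cases ha with
      | rEta _ hu k =>
        rw [Tm.capp.injEq] at hu
        obtain rfl := Tm.rename_succ_injective hu.2.1
        exact key _ k
      | clam k =>
        generalize hw : v.rename Nat.succ = w at k
        cases k with
        | capp k₁ k₂ =>
          cases k₂
          subst hw
          obtain ⟨v', rfl, hv⟩ := k₁.exists_of_rename_succ
          exact rEta hη rfl (key _ hv)
        | rClas k₁ k₂ =>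
          -- The critical pair in which `v` is itself an abstraction `λ∘ (x:Q). v₀`.
          cases k₂
          rw [hw] at h
          obtain rfl := h.annotation_eq
          cases v <;> simp only [Tm.rename, reduceCtorEq, Tm.clam.injEq] at hw
          obtain ⟨rfl, rfl, rfl⟩ := hw
          have := k₁.inst (refl (.var 0))
          rw [Tm.rename_upRen_succ_inst] at this
          exact key _ (clam this)
    · obtain ⟨c, hc⟩ := ih t (by simp) ht
      refine ⟨.clam ε P c, fun a ha => ?_⟩
      cases ha with
      | clam k => exact clam (hc _ k)
      | rEta hη hu _ => exact (hr ⟨hη, _, hu⟩).elim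
  | capp ε t s =>
    have ht : Typable t := h.of_mem_children (by simp [Tm.children])
    obtain ⟨c₂, h₂⟩ := ih s (by simp) (h.of_mem_children (by simp [Tm.children]))
    by_cases hr : ∃ b, Rule (.capp ε t s) b
    · obtain ⟨b, r⟩ := hr
      cases r with
      | clas ε P t s =>
      obtain ⟨c₁, h₁⟩ := ih t (by simp; omega) (ht.of_mem_children (by simp [Tm.children]))
      refine ⟨c₁.inst c₂, fun a ha => ?_⟩
      cases ha with
      | rClas k₁ k₂ => exact (h₁ _ k₁).inst (h₂ _ k₂)
      | capp k₁ k₂ =>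
        cases k₁ with
        | clam k₁ => exact rClas (h₁ _ k₁) (h₂ _ k₂)
        | rEta hη hu k =>
          -- The trivial critical pair: both rules turn `(λ∘ x. (v ∘ x)) ∘ s` into `v ∘ s`.
          subst hu
          have := (h₁ _ (capp (k.rename Nat.succ) .var)).inst (h₂ _ k₂)
          rw [Tm.inst, Tm.subst, ← Tm.inst, Tm.rename_succ_inst] at this
          exact this
    · obtain ⟨c₁, h₁⟩ := ih t (by simp; omega) ht
      refine ⟨.capp ε c₁ c₂, fun a ha => ?_⟩
      cases ha with
      | capp k₁ k₂ => exact capp (h₁ _ k₁) (h₂ _ k₂)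
      | rClas => exact (hr ⟨_, by constructor⟩).elim
  | pair ε t s =>
    obtain ⟨c₁, h₁⟩ := ih t (by simp; omega) (h.of_mem_children (by simp [Tm.children]))
    obtain ⟨c₂, h₂⟩ := ih s (by simp) (h.of_mem_children (by simp [Tm.children]))
    refine ⟨.pair ε c₁ c₂, fun a ha => ?_⟩
    cases ha with | pair k₁ k₂ => exact pair (h₁ _ k₁) (h₂ _ k₂)
  | proj ε i t =>
    have ht : Typable t := h.of_mem_children (by simp [Tm.children])
    by_cases hr : ∃ b, Rule (.proj ε i t) b
    · obtain ⟨b, r⟩ := hr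
      cases r with
      | proj ε i t s =>
      obtain ⟨c₁, h₁⟩ := ih t (by simp; omega) (ht.of_mem_children (by simp [Tm.children]))
      obtain ⟨c₂, h₂⟩ := ih s (by simp; omega) (ht.of_mem_children (by simp [Tm.children]))
      refine ⟨i.pick c₁ c₂, fun a ha => ?_⟩
      cases ha with
      | rProj k₁ k₂ => exact pick i (h₁ _ k₁) (h₂ _ k₂)
      | proj k => cases k with | pair k₁ k₂ => exact rProj (h₁ _ k₁) (h₂ _ k₂)
    · obtain ⟨c₁, h₁⟩ := ih t (by simp) ht
      refine ⟨.proj ε i c₁, fun a ha => ?_⟩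
      cases ha with
      | proj k₁ => exact proj (h₁ _ k₁)
      | rProj => exact (hr ⟨_, by constructor⟩).elim
  | inj ε i t =>
    obtain ⟨c, hc⟩ := ih t (by simp) (h.of_mem_children (by simp [Tm.children]))
    refine ⟨.inj ε i c, fun a ha => ?_⟩
    cases ha with | inj k => exact inj (hc _ k)
  | caseOf ε t P s Q u =>
    have ht : Typable t := h.of_mem_children (by simp [Tm.children])
    obtain ⟨c₂, h₂⟩ := ih s (by simp; omega) (h.of_mem_children (by simp [Tm.children]))
    obtain ⟨c₃, h₃⟩ := ih u (by simp) (h.of_mem_children (by simp [Tm.children]))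
    by_cases hr : ∃ b, Rule (.caseOf ε t P s Q u) b
    · obtain ⟨b, r⟩ := hr
      cases r with
      | caseOf ε i t =>
      obtain ⟨c₁, h₁⟩ := ih t (by simp; omega) (ht.of_mem_children (by simp [Tm.children]))
      refine ⟨(i.pick c₂ c₃).inst c₁, fun a ha => ?_⟩
      cases ha with
      | rCase k₁ k₂ k₃ => exact (pick i (h₂ _ k₂) (h₃ _ k₃)).inst (h₁ _ k₁)
      | caseOf k₁ k₂ k₃ => cases k₁ with | inj k₁ => exact rCase (h₁ _ k₁) (h₂ _ k₂) (h₃ _ k₃)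
    · obtain ⟨c₁, h₁⟩ := ih t (by simp; omega) ht
      refine ⟨.caseOf ε c₁ P c₂ Q c₃, fun a ha => ?_⟩
      cases ha with
      | caseOf k₁ k₂ k₃ => exact caseOf (h₁ _ k₁) (h₂ _ k₂) (h₃ _ k₃)
      | rCase => exact (hr ⟨_, by constructor⟩).elim
  | lam ε P t =>
    obtain ⟨c, hc⟩ := ih t (by simp) (h.of_mem_children (by simp [Tm.children]))
    refine ⟨.lam ε P c, fun a ha => ?_⟩
    cases ha with | lam k => exact lam (hc _ k)
  | app ε t s =>
    have ht : Typable t := h.of_mem_children (by simp [Tm.children])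
    obtain ⟨c₂, h₂⟩ := ih s (by simp) (h.of_mem_children (by simp [Tm.children]))
    by_cases hr : ∃ b, Rule (.app ε t s) b
    · obtain ⟨b, r⟩ := hr
      cases r with
      | lam ε P t s =>
      obtain ⟨c₁, h₁⟩ := ih t (by simp; omega) (ht.of_mem_children (by simp [Tm.children]))
      refine ⟨c₁.inst c₂, fun a ha => ?_⟩
      cases ha with
      | rLam k₁ k₂ => exact (h₁ _ k₁).inst (h₂ _ k₂)
      | app k₁ k₂ => cases k₁ with | lam k₁ => exact rLam (h₁ _ k₁) (h₂ _ k₂)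
    · obtain ⟨c₁, h₁⟩ := ih t (by simp; omega) ht
      refine ⟨.app ε c₁ c₂, fun a ha => ?_⟩
      cases ha with
      | app k₁ k₂ => exact app (h₁ _ k₁) (h₂ _ k₂)
      | rLam => exact (hr ⟨_, by constructor⟩).elim
  | copair ε t s =>
    obtain ⟨c₁, h₁⟩ := ih t (by simp; omega) (h.of_mem_children (by simp [Tm.children]))
    obtain ⟨c₂, h₂⟩ := ih s (by simp) (h.of_mem_children (by simp [Tm.children]))
    refine ⟨.copair ε c₁ c₂, fun a ha => ?_⟩
    cases ha with | copair k₁ k₂ => exact copair (h₁ _ k₁) (h₂ _ k₂)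
  | colam ε t P Q s =>
    have ht : Typable t := h.of_mem_children (by simp [Tm.children])
    obtain ⟨c₃, h₃⟩ := ih s (by simp) (h.of_mem_children (by simp [Tm.children]))
    by_cases hr : ∃ b, Rule (.colam ε t P Q s) b
    · obtain ⟨b, r⟩ := hr
      cases r with
      | colam ε t s =>
      obtain ⟨c₁, h₁⟩ := ih t (by simp; omega) (ht.of_mem_children (by simp [Tm.children]))
      obtain ⟨c₂, h₂⟩ := ih s (by simp; omega) (ht.of_mem_children (by simp [Tm.children]))
      refine ⟨c₃.inst₂ c₁ c₂, fun a ha => ?_⟩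
      cases ha with
      | rColam k₁ k₂ k₃ => exact (h₃ _ k₃).inst₂ (h₁ _ k₁) (h₂ _ k₂)
      | colam k₁ k₃ =>
        cases k₁ with | copair k₁ k₂ => exact rColam (h₁ _ k₁) (h₂ _ k₂) (h₃ _ k₃)
    · obtain ⟨c₁, h₁⟩ := ih t (by simp; omega) ht
      refine ⟨.colam ε c₁ P Q c₃, fun a ha => ?_⟩
      cases ha with
      | colam k₁ k₃ => exact colam (h₁ _ k₁) (h₃ _ k₃)
      | rColam => exact (hr ⟨_, by constructor⟩).elim
  | negI ε t =>
    obtain ⟨c, hc⟩ := ih t (by simp) (h.of_mem_children (by simp [Tm.children]))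
    refine ⟨.negI ε c, fun a ha => ?_⟩
    cases ha with | negI k => exact negI (hc _ k)
  | negE ε t =>
    have ht : Typable t := h.of_mem_children (by simp [Tm.children])
    by_cases hr : ∃ b, Rule (.negE ε t) b
    · obtain ⟨b, r⟩ := hr
      cases r with
      | neg ε t =>
      obtain ⟨c, hc⟩ := ih b (by simp; omega) (ht.of_mem_children (by simp [Tm.children]))
      refine ⟨c, fun a ha => ?_⟩
      cases ha with
      | rNeg k => exact hc _ k
      | negE k => cases k with | negI k => exact rNeg (hc _ k)
    · obtain ⟨c, hc⟩ := ih t (by simp) ht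
      refine ⟨.negE ε c, fun a ha => ?_⟩
      cases ha with
      | negE k => exact negE (hc _ k)
      | rNeg => exact (hr ⟨_, by constructor⟩).elim
  | tlam ε t =>
    obtain ⟨c, hc⟩ := ih t (by simp) (h.of_mem_children (by simp [Tm.children]))
    refine ⟨.tlam ε c, fun a ha => ?_⟩
    cases ha with | tlam k => exact tlam (hc _ k)
  | tapp ε t A =>
    have ht : Typable t := h.of_mem_children (by simp [Tm.children])
    by_cases hr : ∃ b, Rule (.tapp ε t A) b
    · obtain ⟨b, r⟩ := hr
      cases r with
      | tlam ε t =>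
      obtain ⟨c, hc⟩ := ih t (by simp; omega) (ht.of_mem_children (by simp [Tm.children]))
      refine ⟨c.tinst A, fun a ha => ?_⟩
      cases ha with
      | rTlam k => exact (hc _ k).tinst A
      | tapp k => cases k with | tlam k => exact rTlam (hc _ k)
    · obtain ⟨c, hc⟩ := ih t (by simp; omega) ht
      refine ⟨.tapp ε c A, fun a ha => ?_⟩
      cases ha with
      | tapp k => exact tapp (hc _ k)
      | rTlam => exact (hr ⟨_, by constructor⟩).elim
  | pack ε A t =>
    obtain ⟨c, hc⟩ := ih t (by simp) (h.of_mem_children (by simp [Tm.children]))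
    refine ⟨.pack ε A c, fun a ha => ?_⟩
    cases ha with | pack k => exact pack (hc _ k)
  | unpack ε t P s =>
    have ht : Typable t := h.of_mem_children (by simp [Tm.children])
    obtain ⟨c₂, h₂⟩ := ih s (by simp) (h.of_mem_children (by simp [Tm.children]))
    by_cases hr : ∃ b, Rule (.unpack ε t P s) b
    · obtain ⟨b, r⟩ := hr
      cases r with
      | unpack ε A t =>
      obtain ⟨c₁, h₁⟩ := ih t (by simp; omega) (ht.of_mem_children (by simp [Tm.children]))
      refine ⟨(c₂.tinst A).inst c₁, fun a ha => ?_⟩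
      cases ha with
      | rUnpack k₁ k₂ => exact ((h₂ _ k₂).tinst A).inst (h₁ _ k₁)
      | unpack k₁ k₂ => cases k₁ with | pack k₁ => exact rUnpack (h₁ _ k₁) (h₂ _ k₂)
    · obtain ⟨c₁, h₁⟩ := ih t (by simp; omega) ht
      refine ⟨.unpack ε c₁ P c₂, fun a ha => ?_⟩
      cases ha with
      | unpack k₁ k₂ => exact unpack (h₁ _ k₁) (h₂ _ k₂)
      | rUnpack => exact (hr ⟨_, by constructor⟩).elim

theorem Par.of_step {η : Bool} {t s : Tm} (r : Step η t s) : Par η t s := by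
  induction r with
  | root r =>
    rcases r with r | ⟨hη, r⟩
    · cases r <;> constructor <;> exact refl _
    · cases r; exact rEta hη rfl (refl _)
  | _ => constructor <;> first | assumption | exact refl _

/-- Many-step reduction. -/
abbrev Steps (η : Bool) : Tm → Tm → Prop := Relation.ReflTransGen (Step η)

namespace Steps

variable {η : Bool} {ε : Sign} {t t' s s' u u' : Tm} {P Q : Ty}

theorem sabs (h₁ : Steps η t t') (h₂ : Steps η s s') :
    Steps η (.sabs P t s) (.sabs P t' s') :=
  (h₁.lift (Tm.sabs P · s) fun _ _ => .sabsL).trans (h₂.lift (Tm.sabs P t' ·) fun _ _ => .sabsR)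

theorem clam (h : Steps η t t') : Steps η (.clam ε P t) (.clam ε P t') :=
  h.lift _ fun _ _ => .clam

theorem capp (h₁ : Steps η t t') (h₂ : Steps η s s') :
    Steps η (.capp ε t s) (.capp ε t' s') :=
  (h₁.lift (Tm.capp ε · s) fun _ _ => .cappL).trans (h₂.lift (Tm.capp ε t' ·) fun _ _ => .cappR)

theorem pair (h₁ : Steps η t t') (h₂ : Steps η s s') :
    Steps η (.pair ε t s) (.pair ε t' s') :=
  (h₁.lift (Tm.pair ε · s) fun _ _ => .pairL).trans (h₂.lift (Tm.pair ε t' ·) fun _ _ => .pairR)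

theorem proj {i : Idx} (h : Steps η t t') : Steps η (.proj ε i t) (.proj ε i t') :=
  h.lift _ fun _ _ => .proj

theorem inj {i : Idx} (h : Steps η t t') : Steps η (.inj ε i t) (.inj ε i t') :=
  h.lift _ fun _ _ => .inj

theorem caseOf (h₁ : Steps η t t') (h₂ : Steps η s s') (h₃ : Steps η u u') :
    Steps η (.caseOf ε t P s Q u) (.caseOf ε t' P s' Q u') :=
  ((h₁.lift (Tm.caseOf ε · P s Q u) fun _ _ => .case₀).trans
    (h₂.lift (Tm.caseOf ε t' P · Q u) fun _ _ => .case₁)).trans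
    (h₃.lift (Tm.caseOf ε t' P s' Q ·) fun _ _ => .case₂)

theorem lam (h : Steps η t t') : Steps η (.lam ε P t) (.lam ε P t') :=
  h.lift _ fun _ _ => .lam

theorem app (h₁ : Steps η t t') (h₂ : Steps η s s') :
    Steps η (.app ε t s) (.app ε t' s') :=
  (h₁.lift (Tm.app ε · s) fun _ _ => .appL).trans (h₂.lift (Tm.app ε t' ·) fun _ _ => .appR)

theorem copair (h₁ : Steps η t t') (h₂ : Steps η s s') :
    Steps η (.copair ε t s) (.copair ε t' s') :=
  (h₁.lift (Tm.copair ε · s) fun _ _ => .copairL).trans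
    (h₂.lift (Tm.copair ε t' ·) fun _ _ => .copairR)

theorem colam (h₁ : Steps η t t') (h₂ : Steps η s s') :
    Steps η (.colam ε t P Q s) (.colam ε t' P Q s') :=
  (h₁.lift (Tm.colam ε · P Q s) fun _ _ => .colamL).trans
    (h₂.lift (Tm.colam ε t' P Q ·) fun _ _ => .colamR)

theorem negI (h : Steps η t t') : Steps η (.negI ε t) (.negI ε t') :=
  h.lift _ fun _ _ => .negI

theorem negE (h : Steps η t t') : Steps η (.negE ε t) (.negE ε t') :=
  h.lift _ fun _ _ => .negE

theorem tlam (h : Steps η t t') : Steps η (.tlam ε t) (.tlam ε t') :=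
  h.lift _ fun _ _ => .tlam

theorem tapp {A : PType} (h : Steps η t t') : Steps η (.tapp ε t A) (.tapp ε t' A) :=
  h.lift (Tm.tapp ε · A) fun _ _ => .tapp

theorem pack {A : PType} (h : Steps η t t') : Steps η (.pack ε A t) (.pack ε A t') :=
  h.lift _ fun _ _ => .pack

theorem unpack (h₁ : Steps η t t') (h₂ : Steps η s s') :
    Steps η (.unpack ε t P s) (.unpack ε t' P s') :=
  (h₁.lift (Tm.unpack ε · P s) fun _ _ => .unpackL).trans
    (h₂.lift (Tm.unpack ε t' P ·) fun _ _ => .unpackR)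

theorem tail_rule {a b c : Tm} (h : Steps η a b) (r : Rule b c) : Steps η a c :=
  h.tail (.root (.inl r))

end Steps

theorem Par.steps {η : Bool} {t s : Tm} (h : Par η t s) : Steps η t s := by
  induction h with
  | rClas _ _ h₁ h₂ => exact (h₁.clam.capp h₂).tail_rule (.clas ..)
  | rProj _ _ h₁ h₂ => exact (h₁.pair h₂).proj.tail_rule (.proj ..)
  | rCase _ _ _ h₁ h₂ h₃ => exact (h₁.inj.caseOf h₂ h₃).tail_rule (.caseOf ..)
  | rLam _ _ h₁ h₂ => exact (h₁.lam.app h₂).tail_rule (.lam ..)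
  | rColam _ _ _ h₁ h₂ h₃ => exact ((h₁.copair h₂).colam h₃).tail_rule (.colam ..)
  | rNeg _ h => exact h.negI.negE.tail_rule (.neg ..)
  | rTlam _ h => exact h.tlam.tapp.tail_rule (.tlam ..)
  | rUnpack _ _ h₁ h₂ => exact (h₁.pack.unpack h₂).tail_rule (.unpack ..)
  | rAnd _ _ _ h₁ h₂ h₃ => exact ((h₁.pair h₂).sabs h₃.inj).tail_rule (.absAnd ..)
  | rOr _ _ _ h₁ h₂ h₃ => exact (h₁.inj.sabs (h₂.pair h₃)).tail_rule (.absOr ..)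
  | rImp _ _ _ h₁ h₂ h₃ => exact (h₁.lam.sabs (h₂.copair h₃)).tail_rule (.absImp ..)
  | rCoimp _ _ _ h₁ h₂ h₃ => exact ((h₁.copair h₂).sabs h₃.lam).tail_rule (.absCoimp ..)
  | rNot _ _ h₁ h₂ => exact (h₁.negI.sabs h₂.negI).tail_rule (.absNeg ..)
  | rAll _ _ h₁ h₂ => exact (h₁.tlam.sabs h₂.pack).tail_rule (.absAll ..)
  | rEx _ _ h₁ h₂ => exact (h₁.pack.sabs h₂.tlam).tail_rule (.absEx ..)
  | var => exact .refl
  | sabs _ _ h₁ h₂ => exact h₁.sabs h₂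
  | clam _ h => exact h.clam
  | capp _ _ h₁ h₂ => exact h₁.capp h₂
  | pair _ _ h₁ h₂ => exact h₁.pair h₂
  | proj _ h => exact h.proj
  | inj _ h => exact h.inj
  | caseOf _ _ _ h₁ h₂ h₃ => exact h₁.caseOf h₂ h₃
  | lam _ h => exact h.lam
  | app _ _ h₁ h₂ => exact h₁.app h₂
  | copair _ _ h₁ h₂ => exact h₁.copair h₂
  | colam _ _ h₁ h₂ => exact h₁.colam h₂
  | negI _ h => exact h.negI
  | negE _ h => exact h.negE
  | tlam _ h => exact h.tlam
  | tapp _ h => exact h.tapp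
  | pack _ h => exact h.pack
  | unpack _ _ h₁ h₂ => exact h₁.unpack h₂
  | rEta hη hu _ h =>
    subst hu
    exact .head (.root (.inr ⟨hη, .eta ..⟩)) h

theorem Typable.of_step {η : Bool} {t s : Tm} (h : Typable t) (r : Step η t s) : Typable s := by
  obtain ⟨Γ, P, h⟩ := h
  exact ⟨Γ, P, h.of_step r⟩

/-- A reduction that starts from a typable term is a reduction among typable terms. -/
theorem Steps.exists_tsteps {η : Bool} {t s : Tm} (ht : Typable t) (h : Steps η t s) :
    ∃ hs : Typable s, Relation.ReflTransGen (TStep η) ⟨t, ht⟩ ⟨s, hs⟩ := by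
  induction h with
  | refl => exact ⟨ht, .refl⟩
  | tail _ r ih =>
    obtain ⟨hb, h⟩ := ih
    exact ⟨hb.of_step r, h.tail r⟩

theorem churchRosser_tstep (η : Bool) : ChurchRosser (TStep η) := by
  let R : {t : Tm // Typable t} → {t : Tm // Typable t} → Prop := fun a b => Par η a.1 b.1
  have hR : ∀ {a b}, R a b → Relation.ReflTransGen (TStep η) a b := fun {a _} h =>
    (h.steps.exists_tsteps a.2).2
  have hRs : ∀ {a b}, Relation.ReflTransGen R a b → Relation.ReflTransGen (TStep η) a b := by
    intro a b h
    induction h with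
    | refl => exact .refl
    | tail _ h ih => exact ih.trans (hR h)
  have diamond : ∀ a b c, R a b → R a c →
      ∃ d, Relation.ReflGen R b d ∧ Relation.ReflTransGen R c d := by
    intro a b c hb hc
    obtain ⟨d, hd⟩ := Par.exists_complete_development (η := η) a.1 a.2
    obtain ⟨hd', -⟩ := (hd _ hb).steps.exists_tsteps b.2
    exact ⟨⟨d, hd'⟩, .single (hd _ hb), .single (hd _ hc)⟩
  have equiv : Equivalence (Relation.Join (Relation.ReflTransGen R)) :=
    Relation.equivalence_join_reflTransGen diamond
  intro a b h
  have : Relation.Join (Relation.ReflTransGen R) a b := by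
    induction h with
    | rel a b h => exact ⟨b, .single (Par.of_step h), .refl⟩
    | refl a => exact equiv.refl a
    | symm _ _ _ ih => exact equiv.symm ih
    | trans _ _ _ _ _ ih₁ ih₂ => exact equiv.trans ih₁ ih₂
  obtain ⟨c, h₁, h₂⟩ := this
  exact ⟨c, hRs h₁, hRs h₂⟩

/-! ### From `λ^PRK` to classical natural deduction -/

namespace PType

theorem toFormula_rename (ξ : ℕ → ℕ) (A : PType) :
    (A.rename ξ).toFormula = A.toFormula.rename ξ := by
  induction A generalizing ξ <;> simp [rename, toFormula, Formula.rename, *]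

theorem toFormula_shift (A : PType) : A.shift.toFormula = A.toFormula.shift :=
  toFormula_rename _ _

theorem toFormula_up (σ : ℕ → PType) :
    (fun n => (up σ n).toFormula) = Formula.up (fun n => (σ n).toFormula) := by
  funext n; cases n
  · rfl
  · exact toFormula_shift _

theorem toFormula_subst (σ : ℕ → PType) (A : PType) :
    (A.subst σ).toFormula = A.toFormula.subst (fun n => (σ n).toFormula) := by
  induction A generalizing σ <;> simp [subst, toFormula, Formula.subst, toFormula_up, *]

theorem toFormula_inst (B A : PType) :
    (B.inst A).toFormula = B.toFormula.inst A.toFormula := by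
  rw [inst, toFormula_subst, Formula.inst]
  congr 1; funext n; cases n <;> rfl

end PType

/-- The classical reading of a type: affirmations of `A` as `A`, denials of `A` as `¬A`. -/
def Ty.toFormula : Ty → Formula
  | sp A | wp A => A.toFormula
  | sn A | wn A => .not A.toFormula

theorem Ty.toFormula_shift (P : Ty) : P.shift.toFormula = P.toFormula.shift := by
  cases P <;> simp [shift, map, toFormula, PType.toFormula_shift, Formula.shift, Formula.rename]

/-- The classical reading of a typing context. -/
def Ctx.toFormulas (Γ : Ctx) : List Formula := Γ.map Ty.toFormula

theorem Ctx.toFormulas_shift (Γ : Ctx) :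
    Γ.shift.toFormulas = Γ.toFormulas.map Formula.shift := by
  simp [Ctx.toFormulas, Ctx.shift, Ty.toFormula_shift]

namespace NK

theorem weaken {Γ : List Formula} {A : Formula} (h : NK Γ A) :
    ∀ {Δ : List Formula}, Γ ⊆ Δ → NK Δ A := by
  induction h with
  | ax h => exact fun H => .ax (H h)
  | andE i _ ih => exact fun H => .andE i (ih H)
  | orI i _ ih => exact fun H => .orI i (ih H)
  | lem => exact fun _ => .lem
  | allE _ ih => exact fun H => .allE (ih H)
  | exI _ ih => exact fun H => .exI (ih H)
  | botE _ ih => exact fun H => .botE (ih H)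
  | andI _ _ ih₁ ih₂ => exact fun H => .andI (ih₁ H) (ih₂ H)
  | orE _ _ _ ih ih₁ ih₂ =>
    exact fun H => .orE (ih H) (ih₁ (List.cons_subset_cons _ H)) (ih₂ (List.cons_subset_cons _ H))
  | impI _ ih => exact fun H => .impI (ih (List.cons_subset_cons _ H))
  | impE _ _ ih₁ ih₂ => exact fun H => .impE (ih₁ H) (ih₂ H)
  | coimpI _ _ ih₁ ih₂ => exact fun H => .coimpI (ih₁ H) (ih₂ H)
  | coimpE _ _ ih₁ ih₂ =>
    exact fun H => .coimpE (ih₁ H) (ih₂ (List.cons_subset_cons _ (List.cons_subset_cons _ H)))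
  | notI _ ih => exact fun H => .notI (ih (List.cons_subset_cons _ H))
  | notE _ _ ih₁ ih₂ => exact fun H => .notE (ih₁ H) (ih₂ H)
  | allI _ ih => exact fun H => .allI (ih (List.map_subset _ H))
  | exE _ _ ih₁ ih₂ =>
    exact fun H => .exE (ih₁ H) (ih₂ (List.cons_subset_cons _ (List.map_subset _ H)))

variable {Γ : List Formula} {A B C : Formula}

theorem weaken_cons (B : Formula) (h : NK Γ A) : NK (B :: Γ) A :=
  h.weaken (List.subset_cons_self B Γ)

theorem hyp : NK (A :: Γ) A := .ax (by simp)

theorem byContra (h : NK (.not A :: Γ) .bot) : NK Γ A :=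
  .orE .lem hyp (.botE h)

theorem not_of_imp (h : NK (A :: Γ) B) (hB : NK Γ (.not B)) : NK Γ (.not A) :=
  .notI (.notE (hB.weaken_cons A) h)

end NK

open NK in
/-- Soundness of the classical reading: a typing derivation turns into a derivation in `NK` of the
classical readings, rule by rule; the denial rules become classically valid statements on
negations. -/
theorem HasType.toNK {Γ : Ctx} {t : Tm} {P : Ty} (h : HasType Γ t P) :
    NK Γ.toFormulas P.toFormula := by
  induction h with
  | ax h => exact .ax (List.mem_map_of_mem (List.mem_of_getElem? h))
  | abs _ _ h₁ h₂ => exact .botE (.notE h₂ h₁)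
  | clamPos _ h => exact byContra (.notE hyp h)
  | clamNeg _ h => exact .notI (.notE h hyp)
  | cappPos _ _ h _ => exact h
  | cappNeg _ _ h _ => exact h
  | pairPos _ _ h₁ h₂ => exact .andI h₁ h₂
  | pairNeg _ _ h₁ h₂ =>
    exact .notI (.orE hyp (.notE ((h₁.weaken_cons _).weaken_cons _) hyp)
      (.notE ((h₂.weaken_cons _).weaken_cons _) hyp))
  | projPos i _ h =>
    have := NK.andE i h
    rwa [← Idx.pick_apply PType.toFormula] at this
  | projNeg i _ h =>
    refine not_of_imp (NK.orI i ?_) h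
    rw [← Idx.pick_apply PType.toFormula]
    exact hyp
  | injPos i _ h =>
    refine NK.orI i ?_
    rw [← Idx.pick_apply PType.toFormula]
    exact h
  | injNeg i _ h =>
    refine not_of_imp ?_ h
    rw [Idx.pick_apply PType.toFormula]
    exact .andE i hyp
  | casePos _ _ _ h h₁ h₂ => exact .orE h h₁ h₂
  | @caseNeg Γ _ _ _ A B P _ _ _ h h₁ h₂ =>
    refine .orE (A := A.toFormula) .lem (.orE (A := B.toFormula) .lem ?_ ?_) h₁
    · exact .botE (.notE ((h.weaken_cons _).weaken_cons _) (.andI (hyp.weaken_cons _) hyp))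
    · exact h₂.weaken (List.cons_subset_cons _ (List.subset_cons_self _ _))
  | lamPos _ h => exact .impI h
  | lamNeg _ h =>
    refine .notI (.coimpE hyp (.notE ?_ hyp))
    refine (h.weaken ?_).weaken_cons _
    exact List.cons_subset_cons _ (List.subset_cons_self _ _)
  | appPos _ _ h₁ h₂ => exact .impE h₁ h₂
  | appNeg _ _ h₁ h₂ => exact not_of_imp (.coimpI (h₂.weaken_cons _) hyp) h₁
  | copairPos _ _ h₁ h₂ => exact .coimpI h₁ h₂
  | copairNeg _ _ h₁ h₂ => exact not_of_imp (.impE hyp (h₁.weaken_cons _)) h₂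
  | colamPos _ _ h₁ h₂ => exact .coimpE h₁ h₂
  | @colamNeg Γ _ _ A B P _ _ h₁ h₂ =>
    refine .orE (A := B.toFormula) .lem ?_ (.orE (A := A.toFormula) .lem ?_ ?_)
    · exact .botE (.notE (h₁.weaken_cons _) (.impI (hyp.weaken_cons _)))
    · refine h₂.weaken ?_
      intro C hC
      simp only [Ctx.toFormulas, List.map_cons, List.mem_cons, Ty.toFormula] at hC ⊢
      tauto
    · exact .botE (.notE ((h₁.weaken_cons _).weaken_cons _)
        (.impI (.botE (.notE (hyp.weaken_cons _) hyp))))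
  | negIPos _ h => exact h
  | negINeg _ h => exact .notI (.notE hyp (h.weaken_cons _))
  | negEPos _ h => exact h
  | negENeg _ h => exact byContra (.notE (h.weaken_cons _) hyp)
  | tlamPos _ h =>
    rw [Ctx.toFormulas_shift] at h
    exact .allI h
  | @tlamNeg Γ _ A _ h =>
    rw [Ctx.toFormulas_shift] at h
    refine .notI (.exE hyp ?_)
    refine .notE ((h.weaken ?_).weaken_cons _) hyp
    rw [List.map_cons]; exact List.subset_cons_self _ _
  | tappPos _ h =>
    rw [Ty.toFormula, PType.toFormula_inst]
    exact .allE h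
  | tappNeg _ h =>
    rw [Ty.toFormula, PType.toFormula_inst]
    exact not_of_imp (.exI hyp) h
  | packPos _ h =>
    rw [Ty.toFormula, PType.toFormula_inst] at h
    exact .exI h
  | packNeg _ h =>
    rw [Ty.toFormula, PType.toFormula_inst] at h
    exact not_of_imp (.allE hyp) h
  | unpackPos _ _ h₁ h₂ =>
    rw [Ty.toFormula_shift, Ctx.toFormulas, List.map_cons, ← Ctx.toFormulas,
      Ctx.toFormulas_shift] at h₂
    exact .exE h₁ h₂
  | @unpackNeg Γ _ _ A P _ _ h₁ h₂ =>
    rw [Ty.toFormula_shift, Ctx.toFormulas, List.map_cons, ← Ctx.toFormulas,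
      Ctx.toFormulas_shift] at h₂
    refine byContra (.notE (h₁.weaken_cons _) (.allI (byContra ?_)))
    refine .notE (A := P.toFormula.shift) ?_ (h₂.weaken (List.cons_subset_cons _ ?_))
    · exact .ax (by simp [Formula.shift, Formula.rename])
    · rw [List.map_cons]; exact List.subset_cons_self _ _

/-! ### From classical natural deduction to `λ^PRK` -/

namespace Formula

/-- The pure type that represents a formula: `⊥` is represented by `∀α.α`. -/
def toPType : Formula → PType
  | var n => .var n
  | bot => .all (.var 0)
  | and A B => .and A.toPType B.toPType
  | or A B => .or A.toPType B.toPType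
  | imp A B => .imp A.toPType B.toPType
  | coimp A B => .coimp A.toPType B.toPType
  | not A => .not A.toPType
  | all A => .all A.toPType
  | ex A => .ex A.toPType

theorem toPType_rename (ξ : ℕ → ℕ) (A : Formula) :
    (A.rename ξ).toPType = A.toPType.rename ξ := by
  induction A generalizing ξ <;> simp [rename, toPType, PType.rename, *]
  rfl

theorem toPType_shift (A : Formula) : A.shift.toPType = A.toPType.shift :=
  toPType_rename _ _

theorem toPType_up (σ : ℕ → Formula) :
    (fun n => (up σ n).toPType) = PType.up (fun n => (σ n).toPType) := by
  funext n; cases n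
  · rfl
  · exact toPType_shift _

theorem toPType_subst (σ : ℕ → Formula) (A : Formula) :
    (A.subst σ).toPType = A.toPType.subst (fun n => (σ n).toPType) := by
  induction A generalizing σ <;> simp [subst, toPType, PType.subst, toPType_up, *]
  rfl

theorem toPType_inst (B A : Formula) : (B.inst A).toPType = B.toPType.inst A.toPType := by
  rw [inst, toPType_subst, PType.inst]
  congr 1; funext n; cases n <;> rfl

end Formula

theorem PType.toFormula_toPType (A : PType) : A.toFormula.toPType = A := by
  induction A <;> simp [toFormula, Formula.toPType, *]

open Ty

theorem HasType.var_zero {Γ : Ctx} {P : Ty} : HasType (P :: Γ) (.var 0) P := .ax rfl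

/-- A typing context is inconsistent if it derives every type. -/
def Inconsistent (Γ : Ctx) : Prop := ∀ P, Derivable Γ P

namespace Derivable

variable {Γ : Ctx} {A B C : PType} {P Q : Ty}

theorem weaken (Q : Ty) (h : Derivable Γ P) : Derivable (Q :: Γ) P :=
  let ⟨_, h⟩ := h; ⟨_, h.weaken Q⟩

theorem hyp : Derivable (P :: Γ) P := ⟨_, .var_zero⟩

theorem sp_of_wp (h : Derivable Γ (wp A)) (h' : Derivable Γ (wn A)) : Derivable Γ (sp A) :=
  let ⟨_, h⟩ := h; let ⟨_, h'⟩ := h'; ⟨_, .cappPos h h'⟩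

theorem sn_of_wn (h : Derivable Γ (wn A)) (h' : Derivable Γ (wp A)) : Derivable Γ (sn A) :=
  let ⟨_, h⟩ := h; let ⟨_, h'⟩ := h'; ⟨_, .cappNeg h h'⟩

theorem inconsistent (h : Derivable Γ (wp A)) (h' : Derivable Γ (wn A)) : Inconsistent Γ :=
  fun _ => let ⟨_, k⟩ := h.sp_of_wp h'; let ⟨_, k'⟩ := h'.sn_of_wn h; ⟨_, .abs k k'⟩

theorem wp_of_inconsistent (h : Inconsistent (wn A :: Γ)) : Derivable Γ (wp A) :=
  let ⟨_, h⟩ := h (sp A); ⟨_, .clamPos h⟩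

theorem wn_of_inconsistent (h : Inconsistent (wp A :: Γ)) : Derivable Γ (wn A) :=
  let ⟨_, h⟩ := h (sn A); ⟨_, .clamNeg h⟩

theorem wp_of_sp (h : Derivable Γ (sp A)) : Derivable Γ (wp A) :=
  let ⟨_, h⟩ := h; ⟨_, .clamPos (h.weaken _)⟩

theorem wn_of_sn (h : Derivable Γ (sn A)) : Derivable Γ (wn A) :=
  let ⟨_, h⟩ := h; ⟨_, .clamNeg (h.weaken _)⟩

/-- Proof by refutation: to derive `A^⊕`, it suffices to derive a strong denial `B⁻` from `A^⊖`
for some `B` that is affirmed. -/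
theorem wp_of_sn (hB : Derivable Γ (wp B)) (h : Derivable (wn A :: Γ) (sn B)) :
    Derivable Γ (wp A) :=
  wp_of_inconsistent ((hB.weaken _).inconsistent h.wn_of_sn)

theorem contrapose (h : Derivable (wp A :: Γ) (wp B)) :
    Derivable (wn B :: Γ) (wn A) := by
  obtain ⟨t, h⟩ := h
  refine wn_of_inconsistent (inconsistent (A := B) ⟨_, h.rename (ξ := upRen Nat.succ) ?_⟩
    (hyp.weaken _))
  exact getElem?_cons_upRen (fun n Q hn => by simpa using hn) _

theorem wp_and (h : Derivable Γ (wp A)) (h' : Derivable Γ (wp B)) :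
    Derivable Γ (wp (.and A B)) :=
  let ⟨_, h⟩ := h; let ⟨_, h'⟩ := h'; wp_of_sp ⟨_, .pairPos h h'⟩

theorem wp_pick (i : Idx) (h : Derivable Γ (wp (.and A B))) : Derivable Γ (wp (i.pick A B)) :=
  wp_of_sn h ⟨_, .injNeg i .var_zero⟩

theorem wp_or (i : Idx) (h : Derivable Γ (wp (i.pick A B))) : Derivable Γ (wp (.or A B)) :=
  let ⟨_, h⟩ := h; wp_of_sp ⟨_, .injPos i h⟩

theorem wp_or_elim (h : Derivable Γ (wp (.or A B))) (h₁ : Derivable (wp A :: Γ) (wp C))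
    (h₂ : Derivable (wp B :: Γ) (wp C)) : Derivable Γ (wp C) :=
  let ⟨_, h₁⟩ := h₁.contrapose; let ⟨_, h₂⟩ := h₂.contrapose
  wp_of_sn h ⟨_, .pairNeg h₁ h₂⟩

theorem wp_imp (h : Derivable (wp A :: Γ) (wp B)) : Derivable Γ (wp (.imp A B)) :=
  let ⟨_, h⟩ := h; wp_of_sp ⟨_, .lamPos h⟩

theorem wp_imp_elim (h : Derivable Γ (wp (.imp A B))) (h' : Derivable Γ (wp A)) :
    Derivable Γ (wp B) :=
  let ⟨_, h'⟩ := h'; wp_of_sn h ⟨_, .copairNeg (h'.weaken _) .var_zero⟩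

theorem wp_not (h : Derivable Γ (wn A)) : Derivable Γ (wp (.not A)) :=
  let ⟨_, h⟩ := h; wp_of_sp ⟨_, .negIPos h⟩

theorem wn_of_wp_not (h : Derivable Γ (wp (.not A))) : Derivable Γ (wn A) :=
  wn_of_inconsistent ((h.weaken _).inconsistent (wn_of_sn ⟨_, .negINeg .var_zero⟩))

theorem wp_coimp (h : Derivable Γ (wn A)) (h' : Derivable Γ (wp B)) :
    Derivable Γ (wp (.coimp A B)) :=
  let ⟨_, h⟩ := h; let ⟨_, h'⟩ := h'; wp_of_sp ⟨_, .copairPos h h'⟩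

theorem wp_coimp_elim (h : Derivable Γ (wp (.coimp A B)))
    (h' : Derivable (wp B :: wp (.not A) :: Γ) (wp C)) : Derivable Γ (wp C) := by
  obtain ⟨t, h'⟩ := h'.contrapose
  obtain ⟨s, hs⟩ := wp_not (hyp : Derivable (wn A :: wn C :: Γ) (wn A))
  -- In the context `A^⊖, C^⊖, Γ`, replace the hypothesis `(¬A)^⊕` by its derivation `s`.
  refine wp_of_sn h ⟨_, .lamNeg (h'.subst (σ := scons (.var 1) (scons s fun n => .var (n + 2))) ?_)⟩
  intro n Q hn
  rcases n with _ | _ | n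
  · exact .ax (by simpa using hn)
  · obtain rfl : wp (.not A) = Q := by simpa using hn
    exact hs
  · exact .ax (by simpa using hn)

theorem inconsistent_of_wp_bot (h : Derivable Γ (wp (.all (.var 0)))) : Inconsistent Γ := by
  -- To refute `C^⊖`, instantiate `α` by `C` in the strong denial of `∀α.α`.
  have key : ∀ C, Derivable Γ (wp C) := fun C =>
    wp_of_sn h ⟨_, .packNeg (A := C) .var_zero⟩
  exact (key (.var 0)).inconsistent (wn_of_wp_not (key _))

theorem wp_all (h : Derivable Γ.shift (wp A)) : Derivable Γ (wp (.all A)) :=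
  let ⟨_, h⟩ := h; wp_of_sp ⟨_, .tlamPos h⟩

theorem wp_all_elim (h : Derivable Γ (wp (.all B))) : Derivable Γ (wp (B.inst A)) :=
  wp_of_sn h ⟨_, .packNeg .var_zero⟩

theorem wp_ex (h : Derivable Γ (wp (B.inst A))) : Derivable Γ (wp (.ex B)) :=
  let ⟨_, h⟩ := h; wp_of_sp ⟨_, .packPos h⟩

theorem wp_ex_elim (h : Derivable Γ (wp (.ex A)))
    (h' : Derivable (wp A :: Γ.shift) (wp B.shift)) : Derivable Γ (wp B) :=
  let ⟨_, h'⟩ := h'.contrapose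
  wp_of_sn h ⟨_, .tlamNeg h'⟩

theorem wp_lem : Derivable Γ (wp (.or A (.not A))) := by
  refine wp_of_inconsistent (inconsistent (A := .or A (.not A)) ?_ hyp)
  refine wp_or .two (wp_not (wn_of_inconsistent ?_))
  exact inconsistent (wp_or .one hyp) (hyp.weaken _)

end Derivable

theorem map_wp_toPType_shift (Γ : List Formula) :
    (Γ.map Formula.shift).map (fun A => wp A.toPType) =
      Ctx.shift (Γ.map fun A => wp A.toPType) := by
  simp [Ctx.shift, Formula.toPType_shift, Ty.shift, Ty.map]

open Derivable in
/-- Every rule of `NK` is admissible for weak affirmations. -/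
theorem NK.derivable {Γ : List Formula} {A : Formula} (h : NK Γ A) :
    Derivable (Γ.map fun A => wp A.toPType) (wp A.toPType) := by
  induction h with
  | ax h =>
    obtain ⟨n, hn⟩ := List.mem_iff_getElem?.1 h
    exact ⟨.var n, .ax (by simp [hn])⟩
  | botE _ h => exact inconsistent_of_wp_bot h _
  | andI _ _ h₁ h₂ => exact wp_and h₁ h₂
  | andE i _ h => rw [Idx.pick_apply Formula.toPType]; exact wp_pick i h
  | orI i _ h => rw [Idx.pick_apply Formula.toPType] at h; exact wp_or i h
  | orE _ _ _ h h₁ h₂ => exact wp_or_elim h h₁ h₂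
  | impI _ h => exact wp_imp h
  | impE _ _ h₁ h₂ => exact wp_imp_elim h₁ h₂
  | coimpI _ _ h₁ h₂ => exact wp_coimp (wn_of_wp_not h₁) h₂
  | coimpE _ _ h₁ h₂ => exact wp_coimp_elim h₁ h₂
  | notI _ h => exact wp_not (wn_of_inconsistent (inconsistent_of_wp_bot h))
  | notE _ _ h₁ h₂ => exact h₂.inconsistent (wn_of_wp_not h₁) _
  | allI _ h => rw [map_wp_toPType_shift] at h; exact wp_all h
  | allE _ h => rw [Formula.toPType_inst]; exact wp_all_elim h
  | exI _ h => rw [Formula.toPType_inst] at h; exact wp_ex h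
  | exE _ _ h₁ h₂ =>
    rw [List.map_cons, map_wp_toPType_shift, Formula.toPType_shift] at h₂
    exact wp_ex_elim h₁ h₂
  | lem => exact wp_lem

/-- A pure type survives the round trip through formulas, so the two translations of derivations
give both directions. -/
theorem derivable_wp_iff_nk (As : List PType) (B : PType) :
    Derivable (As.map wp) (wp B) ↔ NK (As.map PType.toFormula) B.toFormula := by
  constructor
  · rintro ⟨t, h⟩
    have := h.toNK
    rwa [Ctx.toFormulas, List.map_map] at this
  · intro h
    have := h.derivable
    simpa only [List.map_map, Function.comp_def, PType.toFormula_toPType] using this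

end PRK

theorem mainTheorem1 :
    -- subject reduction
    (∀ (η : Bool) (Γ : PRK.Ctx) (t s : PRK.Tm) (P : PRK.Ty),
      PRK.HasType Γ t P → PRK.Step η t s → PRK.HasType Γ s P) ∧
    -- confluence
    (∀ η : Bool, PRK.ChurchRosser (PRK.TStep η)) ∧
    -- classical refinement
    (∀ (As : List PRK.PType) (B : PRK.PType),
      PRK.Derivable (As.map PRK.Ty.wp) (PRK.Ty.wp B) ↔
        PRK.NK (As.map PRK.PType.toFormula) B.toFormula) :=
  ⟨fun _ _ _ _ _ h r => h.of_step r, PRK.churchRosser_tstep, PRK.derivable_wp_iff_nk⟩
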